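/- Let $(X,d)$ be a metric space. Let $TP(X)$ be the real vector space of finitely supported functions $f:X\to\mathbb R$ with $\sum_v f(v)=0$, with the norm $\|f\|=\inf\sum_k a_k d(u_k,v_k)$, the infimum taken over all finite representations $f=\sum_k a_k(\mathbf 1_{u_k}-\mathbf 1_{v_k})$ with $a_k\ge 0$, and let $TC(X)$ be its completion. A function $t:X\to\mathbb R$ that is Lipschitz defines a continuous linear functional on $TC(X)$, again denoted by $t$, through $t(\mathbf 1_u-\mathbf 1_v)=t(u)-t(v)$. Let $n\ge 1$ and let $x_1,\dots,x_n,y_1,\dots,y_n$ be $2n$ distinct points of $X$, with $V$ the set of these points, such that $\{x_iy_i\}_{i=1}^n$ is a minimum-weight perfect matching of the complete graph on $V$ in which the edge $uv$ has weight $d(u,v)$. Put $f_i=(\mathbf 1_{x_i}-\mathbf 1_{y_i})/d(x_i,y_i)$ and let $L_n\subseteq TC(X)$ be the span of $\{\mathbf 1_{x_i}-\mathbf 1_{y_i}\}_{i=1}^n$. Then there is a surjective continuous linear map $P:TC(X)\to L_n$ with $P g=g$ for all $g\in L_n$ and $\|P\|=1$. Moreover, $P$ can be chosen so that the following holds. Consider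 the linear program with one real variable $z_D$ for every $D\subseteq V$ of odd cardinality: maximize $\sum_D z_D$ subject to $z_D\ge 0$ whenever neither $D$ nor $V\setminus D$ is a single point, and $\sum_{D:\,|D\cap\{u,v\}|=1}z_D\le d(u,v)$ for all $u\ne v$ in $V$. There are an optimal solution $z$ of it with all $z_D\ge 0$, and a family $\mathcal H$ of odd subsets of $V$ that contains all singletons, any two members of which are disjoint or comparable under inclusion, and such that $z_D>0\iff D\in\mathcal H$ for every odd $D$ with $|D|\neq 1$, with the following property. For $D\in\mathcal H$ and $a\in X$ put $$s_D(a)=\min\Big\{\min_{v\in D}\max\Big\{d(a,v)-\sum_{E\in\mathcal H,\ v\in E\subsetneq D}z_E,\ 0\Big\},\ z_D\Big\},$$ $$t_i(a)=\sum_{D\in\mathcal H,\ y_i\in D,\ x_i\notin D}s_D(a)-\sum_{D\in\mathcal H,\ x_i\in D,\ y_i\notin D}s_D(a).$$ Then every $t_i$ is $1$-Lipschitz, $t_i(f_j)=1$ if $i=j$ and $t_i(f_j)=0$ otherwise, and $P(f)=\sum_{i=1}^n t_i(f)f_i$ for all $f\in TC(X)$. -/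

import Mathlib

namespace TransportCost

/-! ## Transportation problems and the transportation cost norm -/

/-- The finitely supported functions `f : X → ℝ` with `∑ v, f v = 0`. -/
noncomputable def zeroSum (X : Type*) : Submodule ℝ (X →₀ ℝ) :=
  LinearMap.ker (Finsupp.linearCombination ℝ (fun _ : X => (1 : ℝ)))

/-- The vector space `TP(X)` of transportation problems on `X` (a separate type, because it
carries the transportation cost norm below). -/
def TP (X : Type*) : Type _ := ↥(zeroSum X)

noncomputable instance (X : Type*) : AddCommGroup (TP X) :=
  inferInstanceAs (AddCommGroup ↥(zeroSum X))

noncomputable instance (X : Type*) : Module ℝ (TP X) :=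
  inferInstanceAs (Module ℝ ↥(zeroSum X))

/-- The inclusion of `TP(X)` in the finitely supported functions. -/
noncomputable def TP.toFun {X : Type*} : TP X →ₗ[ℝ] (X →₀ ℝ) := (zeroSum X).subtype

theorem TP.toFun_injective {X : Type*} : Function.Injective (TP.toFun (X := X)) :=
  Subtype.val_injective

/-- The transportation problem `1_u - 1_v`. -/
noncomputable def dipole {X : Type*} (u v : X) : TP X :=
  ⟨Finsupp.single u 1 - Finsupp.single v 1, by simp [zeroSum]⟩

theorem toFun_dipole {X : Type*} (u v : X) :
    TP.toFun (dipole u v) = Finsupp.single u 1 - Finsupp.single v 1 := rfl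

theorem dipole_swap {X : Type*} (u v : X) : dipole v u = -dipole u v := by
  apply TP.toFun_injective
  rw [map_neg, toFun_dipole, toFun_dipole, neg_sub]

/-- `κ` is the cost `∑ aᵢ d(xᵢ, yᵢ)` of some transportation plan
`f = ∑ aᵢ (1_{xᵢ} - 1_{yᵢ})`, `aᵢ ≥ 0`, for `f`. -/
def IsPlanCost {X : Type*} [MetricSpace X] (f : TP X) (κ : ℝ) : Prop :=
  ∃ (m : ℕ) (a : Fin m → ℝ) (x y : Fin m → X), (∀ i, 0 ≤ a i) ∧
    f = ∑ i, a i • dipole (x i) (y i) ∧ κ = ∑ i, a i * dist (x i) (y i)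

/-- The transportation cost: the infimum of the costs of the transportation plans for `f`. -/
noncomputable instance {X : Type*} [MetricSpace X] : Norm (TP X) :=
  ⟨fun f => sInf {κ | IsPlanCost f κ}⟩

section
variable {X : Type*} [MetricSpace X]

theorem norm_def (f : TP X) : ‖f‖ = sInf {κ | IsPlanCost f κ} := rfl

theorem IsPlanCost.nonneg {f : TP X} {κ : ℝ} (h : IsPlanCost f κ) : 0 ≤ κ := by
  obtain ⟨m, a, x, y, ha, -, rfl⟩ := h
  exact Finset.sum_nonneg fun i _ => mul_nonneg (ha i) dist_nonneg

theorem bddBelow_cost (f : TP X) : BddBelow {κ | IsPlanCost f κ} :=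
  ⟨0, fun _ h => IsPlanCost.nonneg h⟩

theorem IsPlanCost.norm_le {f : TP X} {κ : ℝ} (h : IsPlanCost f κ) : ‖f‖ ≤ κ :=
  csInf_le (bddBelow_cost f) h

theorem IsPlanCost.add {f g : TP X} {κ μ : ℝ} (hf : IsPlanCost f κ) (hg : IsPlanCost g μ) :
    IsPlanCost (f + g) (κ + μ) := by
  obtain ⟨m, a, x, y, ha, rfl, rfl⟩ := hf
  obtain ⟨k, b, u, v, hb, rfl, rfl⟩ := hg
  refine ⟨m + k, Fin.append a b, Fin.append x u, Fin.append y v, ?_, ?_, ?_⟩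
  · intro i
    refine Fin.addCases (fun j => ?_) (fun j => ?_) i
    · simpa using ha j
    · simpa using hb j
  · simp [Fin.sum_univ_add]
  · simp [Fin.sum_univ_add]

theorem IsPlanCost.smul {f : TP X} {κ : ℝ} (c : ℝ) (hf : IsPlanCost f κ) :
    IsPlanCost (c • f) (|c| * κ) := by
  obtain ⟨m, a, x, y, ha, rfl, rfl⟩ := hf
  rcases le_total 0 c with hc | hc
  · refine ⟨m, fun i => c * a i, x, y, fun i => mul_nonneg hc (ha i), ?_, ?_⟩
    · simp [Finset.smul_sum, mul_smul]
    · simp [Finset.mul_sum, abs_of_nonneg hc, mul_assoc]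
  · refine ⟨m, fun i => -c * a i, y, x, fun i => mul_nonneg (by linarith) (ha i), ?_, ?_⟩
    · simp [Finset.smul_sum, mul_smul, dipole_swap (x _) (y _)]
    · simp [Finset.mul_sum, abs_of_nonpos hc, mul_assoc, dist_comm]

theorem IsPlanCost.zero : IsPlanCost (0 : TP X) 0 :=
  ⟨0, Fin.elim0, Fin.elim0, Fin.elim0, fun i => i.elim0, by simp, by simp⟩

theorem isPlanCost_dipole (u v : X) : IsPlanCost (dipole u v) (dist u v) :=
  ⟨1, fun _ => 1, fun _ => u, fun _ => v, fun _ => zero_le_one, by simp, by simp⟩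

/-- Every transportation problem has a transportation plan. -/
theorem exists_planCost (f : TP X) : ∃ κ, IsPlanCost f κ := by
  by_cases hX : Nonempty X
  · obtain ⟨o⟩ := hX
    have key : ∀ s : Finset X, ∃ κ, IsPlanCost (∑ v ∈ s, TP.toFun f v • dipole v o) κ := by
      classical
      intro s
      induction s using Finset.induction_on with
      | empty => exact ⟨0, by simpa using IsPlanCost.zero⟩
      | insert v s hv ih =>
        obtain ⟨κ, hκ⟩ := ih
        rw [Finset.sum_insert hv]
        exact ⟨_, ((isPlanCost_dipole v o).smul _).add hκ⟩
    have hf : f = ∑ v ∈ (TP.toFun f).support, TP.toFun f v • dipole v o := by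
      apply TP.toFun_injective
      have h0 : ∑ v ∈ (TP.toFun f).support, TP.toFun f v = 0 := by
        have h1 : Finsupp.linearCombination ℝ (fun _ : X => (1 : ℝ)) (TP.toFun f) = 0 := f.2
        simpa [Finsupp.linearCombination_apply, Finsupp.sum] using h1
      simp only [map_sum, map_smul, toFun_dipole, smul_sub, Finset.sum_sub_distrib]
      rw [← Finset.sum_smul, h0, zero_smul, sub_zero]
      conv_lhs => rw [← Finsupp.sum_single (TP.toFun f)]
      simp [Finsupp.sum]
    rw [hf]
    exact key _
  · have hf : f = 0 := by
      apply TP.toFun_injective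
      ext v
      exact (hX ⟨v⟩).elim
    exact ⟨0, hf ▸ IsPlanCost.zero⟩

theorem le_norm {f : TP X} {r : ℝ} (h : ∀ κ, IsPlanCost f κ → r ≤ κ) : r ≤ ‖f‖ :=
  le_csInf (exists_planCost f) h

theorem tp_norm_smul_le (c : ℝ) (f : TP X) : ‖c • f‖ ≤ |c| * ‖f‖ := by
  rcases eq_or_ne c 0 with rfl | hc
  · simpa using (IsPlanCost.zero (X := X)).norm_le
  · have hc' : 0 < |c| := abs_pos.2 hc
    rw [mul_comm, ← div_le_iff₀ hc']
    refine le_norm fun κ hκ => ?_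
    rw [div_le_iff₀ hc', mul_comm]
    exact (hκ.smul c).norm_le

/-- The pairing of a transportation problem with a `1`-Lipschitz function is at most its cost. -/
theorem pairing_le_norm (f : TP X) (g : X → ℝ) (hg : LipschitzWith 1 g) :
    Finsupp.linearCombination ℝ g (TP.toFun f) ≤ ‖f‖ := by
  refine le_norm fun κ hκ => ?_
  obtain ⟨m, a, x, y, ha, rfl, rfl⟩ := hκ
  simp only [map_sum, map_smul, toFun_dipole, map_sub, Finsupp.linearCombination_single,
    smul_eq_mul, one_mul]
  refine Finset.sum_le_sum fun i _ => mul_le_mul_of_nonneg_left ?_ (ha i)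
  have := hg.dist_le_mul (x i) (y i)
  rw [Real.dist_eq, NNReal.coe_one, one_mul] at this
  exact (le_abs_self _).trans this

theorem eq_zero_of_norm_eq_zero {f : TP X} (hf : ‖f‖ = 0) : f = 0 := by
  classical
  have hneg : ‖-f‖ ≤ 0 := by simpa [hf] using tp_norm_smul_le (-1) f
  apply TP.toFun_injective
  rw [map_zero]
  by_contra hne
  obtain ⟨v, hv⟩ := Finsupp.support_nonempty_iff.2 hne
  -- a `1`-Lipschitz bump that vanishes on the rest of the support
  obtain ⟨δ, hδ, hsep⟩ : ∃ δ > 0, ∀ w ∈ (TP.toFun f).support, w ≠ v → δ ≤ dist w v := by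
    by_cases hs : ((TP.toFun f).support.erase v).Nonempty
    · obtain ⟨w, hw, hmin⟩ := Finset.exists_min_image _ (fun w => dist w v) hs
      exact ⟨dist w v, dist_pos.2 (Finset.ne_of_mem_erase hw), fun u hu huv =>
        hmin u (Finset.mem_erase.2 ⟨huv, hu⟩)⟩
    · exact ⟨1, one_pos, fun w hw hwv => (hs ⟨w, Finset.mem_erase.2 ⟨hwv, hw⟩⟩).elim⟩
  let g : X → ℝ := fun w => max (δ - dist w v) 0
  have hg : LipschitzWith 1 g := by
    refine LipschitzWith.of_le_add fun u w => ?_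
    have h1 := dist_triangle w u v
    rw [dist_comm w u] at h1
    refine max_le ?_ (add_nonneg (le_max_right _ _) dist_nonneg)
    have := le_max_left (δ - dist w v) 0
    change _ ≤ max (δ - dist w v) 0 + _
    linarith
  have hval : Finsupp.linearCombination ℝ g (TP.toFun f) = TP.toFun f v * δ := by
    rw [Finsupp.linearCombination_apply, Finsupp.sum, Finset.sum_eq_single v]
    · simp [g, hδ.le]
    · intro w hw hwv
      have := hsep w hw hwv
      simp [g, this]
    · intro h
      exact (h hv).elim
  have h1 := pairing_le_norm f g hg
  have h2 := pairing_le_norm (-f) g hg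
  rw [map_neg, map_neg, hval] at h2
  rw [hval, hf] at h1
  have h3 : TP.toFun f v * δ = 0 := by linarith
  rcases mul_eq_zero.1 h3 with h | h
  · exact (Finsupp.mem_support_iff.1 hv) h
  · exact hδ.ne' h

theorem tpCore : NormedSpace.Core ℝ (TP X) where
  norm_nonneg _ := le_norm fun _ h => h.nonneg
  norm_smul c f := by
    refine le_antisymm (tp_norm_smul_le c f) ?_
    rcases eq_or_ne c 0 with rfl | hc
    · simpa using le_norm (f := (0 : ℝ) • f) fun _ h => h.nonneg
    · have h := tp_norm_smul_le c⁻¹ (c • f)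
      rw [smul_smul, inv_mul_cancel₀ hc, one_smul, abs_inv,
        inv_mul_eq_div, le_div_iff₀ (abs_pos.2 hc)] at h
      rw [Real.norm_eq_abs, mul_comm]
      exact h
  norm_triangle f g := by
    have h1 : ∀ μ, IsPlanCost g μ → ‖f + g‖ - μ ≤ ‖f‖ := fun μ hμ =>
      le_norm fun κ hκ => by linarith [(hκ.add hμ).norm_le]
    have h2 : ‖f + g‖ - ‖f‖ ≤ ‖g‖ := le_norm fun μ hμ => by linarith [h1 μ hμ]
    linarith
  norm_eq_zero_iff f :=
    ⟨eq_zero_of_norm_eq_zero, by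
      rintro rfl
      exact le_antisymm IsPlanCost.zero.norm_le (le_norm fun _ h => h.nonneg)⟩

end

noncomputable instance {X : Type*} [MetricSpace X] : NormedAddCommGroup (TP X) :=
  NormedAddCommGroup.ofCore tpCore

noncomputable instance {X : Type*} [MetricSpace X] : NormedSpace ℝ (TP X) :=
  NormedSpace.ofCore tpCore

/-- The transportation cost space `TC(X)`: the completion of `TP(X)`. -/
abbrev TC (X : Type*) [MetricSpace X] : Type _ := UniformSpace.Completion (TP X)

/-- The element `1_u - 1_v` of `TC(X)`. -/
noncomputable def tcDipole {X : Type*} [MetricSpace X] (u v : X) : TC X :=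
  ((dipole u v : TP X) : UniformSpace.Completion (TP X))

/-- The subspace of `TC(X)` spanned by the vectors `1_{x i} - 1_{y i}`. -/
noncomputable def pairSpan {X : Type*} [MetricSpace X] {n : ℕ} (x y : Fin n → X) :
    Submodule ℝ (TC X) :=
  Submodule.span ℝ (Set.range fun i => tcDipole (x i) (y i))

/-- The continuous linear functional `τ` on `TC(X)` is the one given by the function `t` on `X`:
it sends `1_u - 1_v` to `t u - t v` (these vectors span the dense subspace `TP(X)`). -/
def IsInducedBy {X : Type*} [MetricSpace X] (τ : TC X →L[ℝ] ℝ) (t : X → ℝ) : Prop :=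
  ∀ u v, τ (tcDipole u v) = t u - t v

/-! ## Minimum-weight perfect matchings

The vertices of a complete weighted graph are the elements of a finite type `V`, placed in `X` by
an injective map `p`; the weight of the edge `uv` is `d(p u, p v)`. -/

/-- The weight of an edge. -/
noncomputable def edgeWeight {X V : Type*} [MetricSpace X] (p : V → X) : Sym2 V → ℝ :=
  Sym2.lift ⟨fun u v => dist (p u) (p v), fun _ _ => dist_comm _ _⟩

/-- The total weight of the edges of a subgraph of the complete graph. -/
noncomputable def weight {X V : Type*} [MetricSpace X] (p : V → X)
    (M : (⊤ : SimpleGraph V).Subgraph) : ℝ :=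
  ∑ᶠ e ∈ M.edgeSet, edgeWeight p e

def IsMinWeightPerfectMatching {X V : Type*} [MetricSpace X] (p : V → X)
    (M : (⊤ : SimpleGraph V).Subgraph) : Prop :=
  M.IsPerfectMatching ∧
    ∀ M' : (⊤ : SimpleGraph V).Subgraph, M'.IsPerfectMatching → weight p M ≤ weight p M'

/-- On the `2n` vertices `inl i`, `inr i`, the subgraph with the edges `{inl i, inr i}`. -/
def pairMatching (n : ℕ) : (⊤ : SimpleGraph (Fin n ⊕ Fin n)).Subgraph where
  verts := Set.univ
  Adj u v := ∃ i, (u = Sum.inl i ∧ v = Sum.inr i) ∨ (u = Sum.inr i ∧ v = Sum.inl i)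
  adj_sub := by
    rintro u v ⟨i, ⟨rfl, rfl⟩ | ⟨rfl, rfl⟩⟩ <;> simp
  edge_vert := fun _ => Set.mem_univ _
  symm := by
    refine ⟨?_⟩
    rintro u v ⟨i, h | h⟩
    · exact ⟨i, Or.inr ⟨h.2, h.1⟩⟩
    · exact ⟨i, Or.inl ⟨h.2, h.1⟩⟩

/-! ## The dual of the matching linear program

The dual variables are indexed by the vertex sets `D` of odd size; `z D` is the weight of the odd
cut between `D` and its complement. (A cut is thus represented by both of its sides, and its
weight is the sum of the two; neither the feasible cut weights nor the objective change.) -/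

section
variable {X V : Type*} [MetricSpace X] [Fintype V] [DecidableEq V]

/-- The vertex sets of odd size. -/
def oddSets (V : Type*) [Fintype V] [DecidableEq V] : Finset (Finset V) :=
  Finset.univ.filter fun D => Odd D.card

/-- The odd cut of `D` is trivial when one of its sides is a single vertex. -/
def IsTrivialCut (D : Finset V) : Prop := D.card = 1 ∨ Dᶜ.card = 1

/-- The edge `uv` belongs to the cut of `D`. -/
def Separates (D : Finset V) (u v : V) : Prop := ¬ (u ∈ D ↔ v ∈ D)

instance (D : Finset V) (u v : V) : Decidable (Separates D u v) :=
  inferInstanceAs (Decidable (¬ (u ∈ D ↔ v ∈ D)))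

/-- Feasibility for the dual program: nontrivial odd cuts have nonnegative weights, and the
weights of the odd cuts that contain an edge add up to at most the weight of the edge. -/
def IsDualFeasible (p : V → X) (z : Finset V → ℝ) : Prop :=
  (∀ D ∈ oddSets V, ¬ IsTrivialCut D → 0 ≤ z D) ∧
    ∀ u v, u ≠ v → ∑ D ∈ oddSets V with Separates D u v, z D ≤ dist (p u) (p v)

/-- Optimality for the dual program, whose objective is the sum of all variables. -/
def IsDualOptimal (p : V → X) (z : Finset V → ℝ) : Prop :=
  IsDualFeasible p z ∧
    ∀ z', IsDualFeasible p z' → ∑ D ∈ oddSets V, z' D ≤ ∑ D ∈ oddSets V, z D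

/-- `z` is a nonnegative optimal dual solution which, apart from single vertices, is positive
exactly on the laminar (nested) family `H` of odd sets. -/
structure IsLaminarOptimalDual (p : V → X) (z : Finset V → ℝ) (H : Finset (Finset V)) :
    Prop where
  optimal : IsDualOptimal p z
  nonneg : ∀ D ∈ oddSets V, 0 ≤ z D
  odd : H ⊆ oddSets V
  laminar : ∀ D ∈ H, ∀ T ∈ H, D ⊆ T ∨ T ⊆ D ∨ Disjoint D T
  singleton_mem : ∀ v, {v} ∈ H
  pos_iff : ∀ D ∈ oddSets V, D.card ≠ 1 → (0 < z D ↔ D ∈ H)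

/-- The function
`a ↦ min (min_{v ∈ D} max (d(a, v) - ∑_{v ∈ E ⊊ D, E ∈ H} z E) 0) (z D)` on `X`. -/
noncomputable def moat (p : V → X) (z : Finset V → ℝ) (H : Finset (Finset V)) (D : Finset V)
    (a : X) : ℝ :=
  min (⨅ v : {v // v ∈ D}, max (dist a (p v) - ∑ E ∈ H with v.1 ∈ E ∧ E ⊂ D, z E) 0) (z D)

/-- The function attached to the edge `uv`: the moat functions of the members of `H` that contain
`v` but not `u`, minus those of the members that contain `u` but not `v`. -/
noncomputable def edgeFunction (p : V → X) (z : Finset V → ℝ) (H : Finset (Finset V)) (u v : V)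
    (a : X) : ℝ :=
  (∑ D ∈ H with v ∈ D ∧ u ∉ D, moat p z H D a) -
    (∑ D ∈ H with u ∈ D ∧ v ∉ D, moat p z H D a)

end

end TransportCost

open TransportCost

namespace TransportCost

/-! The proof establishes LP duality for matchings directly and then reads the optimal dual weights
as widths of moats around odd sets.

Duality. Among the nonnegative dual solutions take a lexicographically extremal one
(`IsExtremalPacking`): largest total weight, then smallest `∑ |D| z D`, then largest `∑ |D|² z D`.
The last two criteria force the sets of positive weight to be laminar, by uncrossing
(`IsExtremalPacking.laminar`). Extremality also forces tight edges to match the maximal proper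
subsets (children) of each member, up to one child containing a prescribed vertex
(`exists_child_matching`): otherwise a Tutte barrier would yield an improving direction
(`barrier_le`). Descending the tree of children gives a perfect matching of weight `∑ z D`
(`exists_near_matching`). The given matching is minimal, so with weak duality all inequalities are
equalities: every edge `x i y i` is tight and every set of positive weight is crossed by exactly one
of these edges (`exists_isLaminarPacking_slack`).

Geometry. A member `D` carries a moat of width `z D`, and `moat` measures how much of it a point has
crossed. The cut constraints keep the moats from overlapping, so on the way from `a` to `b` the
total change of all moat functions is at most `d(a, b)` (`sum_abs_moat_sub_le`). Each moat of
positive width enters exactly one `t i`, with sign `±1`; hence `∑ |t i a - t i b| ≤ d(a, b)`, which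
is stronger than each `t i` being `1`-Lipschitz. On vertices the moat function of `D` is `0` inside
`D` and `z D` outside, so slackness gives biorthogonality. The joint bound extends to `∑ |t i f| ≤
‖f‖` on `TC(X)`, and `‖f i‖ ≤ 1` then gives `‖P‖ ≤ 1`. -/

/-! ### Tutte's theorem with involutions and barriers -/

/-- Tutte's theorem for a symmetric relation on a finite set of even size: a matching given as a
fixed-point free involution, or a barrier `A` with a family `𝒞` of odd components. -/
theorem exists_involution_or_barrier {α : Type*} [DecidableEq α] (S : Finset α)
    (r : α → α → Prop) (hr : ∀ a b, r a b → r b a) (hS : Even S.card) :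
    (∃ m : α → α, ∀ c ∈ S, m c ∈ S ∧ m (m c) = c ∧ m c ≠ c ∧ r c (m c)) ∨
    ∃ (A : Finset α) (𝒞 : Finset (Finset α)), A ⊆ S ∧
      (∀ C ∈ 𝒞, C ⊆ S ∧ Disjoint C A ∧ Odd C.card ∧
        ∀ c ∈ C, ∀ b ∈ S, r c b → b ∈ C ∨ b ∈ A) ∧
      (∀ C ∈ 𝒞, ∀ C' ∈ 𝒞, C ≠ C' → Disjoint C C') ∧ A.card + 2 ≤ 𝒞.card := by
  classical
  let G : SimpleGraph S := SimpleGraph.fromRel fun a b => r a.1 b.1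
  have hG : ∀ a b : S, G.Adj a b ↔ a ≠ b ∧ r a.1 b.1 := by
    intro a b
    simp only [G, SimpleGraph.fromRel_adj]
    exact and_congr_right fun _ => ⟨fun h => h.elim id (hr _ _), Or.inl⟩
  by_cases hM : ∃ M : G.Subgraph, M.IsPerfectMatching
  · left
    obtain ⟨M, hM⟩ := hM
    rw [SimpleGraph.Subgraph.isPerfectMatching_iff] at hM
    choose w hw huniq using hM
    refine ⟨fun c => if h : c ∈ S then (w ⟨c, h⟩).1 else c, fun c hc => ?_⟩
    have hadj := (hG _ _).1 (M.adj_sub (hw ⟨c, hc⟩))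
    have hww : w (w ⟨c, hc⟩) = ⟨c, hc⟩ := (huniq _ _ ((M.adj_comm _ _).1 (hw ⟨c, hc⟩))).symm
    simp only [hc, dif_pos, Subtype.coe_eta, Finset.coe_mem, hww]
    exact ⟨trivial, trivial, fun h => hadj.1 (Subtype.ext h.symm), hadj.2⟩
  · right
    rw [SimpleGraph.tutte] at hM
    push Not at hM
    obtain ⟨u, hu⟩ := hM
    unfold SimpleGraph.IsTutteViolator at hu
    set K := ((⊤ : G.Subgraph).deleteVerts u) with hK
    have hverts : ∀ a : S, a ∈ K.verts ↔ a ∉ u := by simp [hK]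
    let toS : K.verts → α := fun w => w.1.1
    have hinj : Function.Injective toS := fun a b h => Subtype.ext (Subtype.ext h)
    let comp : K.coe.ConnectedComponent → Finset α :=
      fun c => (c.supp.toFinite.toFinset).image toS
    have hmem : ∀ c (a : K.verts), toS a ∈ comp c ↔ K.coe.connectedComponentMk a = c := by
      intro c a
      simp only [comp, Finset.mem_image, Set.Finite.mem_toFinset]
      constructor
      · rintro ⟨b, hb, hab⟩
        rw [← hinj hab]
        exact hb
      · intro h
        exact ⟨a, h, rfl⟩
    have hcomp : ∀ c, ∀ a ∈ comp c, ∃ b : K.verts, toS b = a := by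
      intro c a ha
      obtain ⟨b, -, hb⟩ := Finset.mem_image.1 ha
      exact ⟨b, hb⟩
    have hcinj : Function.Injective comp := by
      intro c c' h
      obtain ⟨a, rfl⟩ := c.exists_rep
      have h1 : toS a ∈ comp (K.coe.connectedComponentMk a) := (hmem _ _).2 rfl
      change comp (K.coe.connectedComponentMk a) = _ at h
      rw [h] at h1
      exact (hmem _ _).1 h1
    let A : Finset α := (u.toFinite.toFinset).image Subtype.val
    let 𝒞 : Finset (Finset α) := (K.coe.oddComponents.toFinite.toFinset).image comp
    have hAc : A.card = u.ncard := by
      rw [Finset.card_image_of_injective _ Subtype.val_injective, Set.ncard_eq_toFinset_card u]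
    have hCc : 𝒞.card = K.coe.oddComponents.ncard := by
      rw [Finset.card_image_of_injective _ hcinj, Set.ncard_eq_toFinset_card]
    have hAmem : ∀ a : S, a.1 ∈ A ↔ a ∈ u := by
      intro a
      simp [A]
    refine ⟨A, 𝒞, ?_, ?_, ?_, ?_⟩
    · intro a ha
      obtain ⟨b, -, rfl⟩ := Finset.mem_image.1 ha
      exact b.2
    · intro C hC
      obtain ⟨c, hc, rfl⟩ := Finset.mem_image.1 hC
      refine ⟨?_, ?_, ?_, ?_⟩
      · intro a ha
        obtain ⟨b, rfl⟩ := hcomp c a ha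
        exact b.1.2
      · rw [Finset.disjoint_left]
        intro a ha haA
        obtain ⟨b, rfl⟩ := hcomp c a ha
        exact (hverts b.1).1 b.2 ((hAmem b.1).1 haA)
      · rw [Finset.card_image_of_injective _ hinj, ← Set.ncard_eq_toFinset_card]
        simpa using hc
      · intro a ha b hb hab
        obtain ⟨a, rfl⟩ := hcomp c a ha
        by_cases hbu : (⟨b, hb⟩ : S) ∈ u
        · exact Or.inr ((hAmem ⟨b, hb⟩).2 hbu)
        · left
          by_cases hne : toS a = b
          · exact hne ▸ ha
          have hbK := (hverts ⟨b, hb⟩).2 hbu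
          have hadj : K.coe.Adj a ⟨⟨b, hb⟩, hbK⟩ := by
            refine SimpleGraph.Subgraph.deleteVerts_adj.2
              ⟨trivial, (hverts a.1).1 a.2, trivial, hbu, ?_⟩
            rw [SimpleGraph.Subgraph.top_adj, hG]
            exact ⟨fun h => hne (congrArg Subtype.val h), hab⟩
          have := (hmem c a).1 ha
          rw [SimpleGraph.ConnectedComponent.connectedComponentMk_eq_of_adj hadj] at this
          exact (hmem c ⟨⟨b, hb⟩, hbK⟩).2 this
    · intro C hC C' hC' hne
      obtain ⟨c, -, rfl⟩ := Finset.mem_image.1 hC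
      obtain ⟨c', -, rfl⟩ := Finset.mem_image.1 hC'
      rw [Finset.disjoint_left]
      intro a ha ha'
      obtain ⟨b, rfl⟩ := hcomp c a ha
      exact hne (by rw [← (hmem c b).1 ha, ← (hmem c' b).1 ha'])
    · have hodd := SimpleGraph.odd_ncard_oddComponents (G := K.coe)
      have hcard : Nat.card K.verts + u.ncard = S.card := by
        have h1 : K.verts = uᶜ := by
          ext a
          simp [hverts]
        rw [h1, Nat.card_coe_set_eq, add_comm, Set.ncard_add_ncard_compl]
        simp
      rw [hCc, hAc]
      -- The number of odd components has the parity of `|S| - |u|`, hence of `|u|`, so an excess of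
      -- at least one is an excess of at least two.
      have h1 : ¬ (K.coe.oddComponents.ncard = u.ncard + 1) := by
        intro h
        rw [h] at hodd
        rcases Nat.even_or_odd u.ncard with he | ho
        · have := hodd.1 he.add_one
          have := this.add_even he
          rw [hcard] at this
          exact (Nat.not_odd_iff_even.2 hS) this
        · have h2 : ¬ Odd (Nat.card K.verts) := fun h => by
            have := hodd.2 h
            exact (Nat.not_odd_iff_even.2 ho.add_one) this
          have := (Nat.not_odd_iff_even.1 h2).add_odd ho
          rw [hcard] at this
          exact (Nat.not_odd_iff_even.2 hS) this
      omega

/-! ### Extremal packings and uncrossing -/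

section
variable {X V : Type*} [MetricSpace X] [Fintype V] [DecidableEq V]

/-- The linear functional `w ↦ ∑ g D * w D`, the sum running over the odd sets. -/
noncomputable def oddPairing (g : Finset V → ℝ) : (Finset V → ℝ) →ₗ[ℝ] ℝ :=
  ∑ D ∈ oddSets V, g D • LinearMap.proj D

theorem oddPairing_apply (g w : Finset V → ℝ) :
    oddPairing g w = ∑ D ∈ oddSets V, g D * w D := by
  simp [oddPairing]

theorem mem_oddSets {D : Finset V} : D ∈ oddSets V ↔ Odd D.card := by
  simp [oddSets]

theorem oddPairing_single (g : Finset V → ℝ) (D : Finset V) (hD : D ∈ oddSets V) :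
    oddPairing g (Pi.single D 1) = g D := by
  rw [oddPairing_apply, Finset.sum_eq_single D] <;> simp +contextual [hD]

theorem oddPairing_single_of_notMem (g : Finset V → ℝ) (D : Finset V) (hD : D ∉ oddSets V) :
    oddPairing g (Pi.single D 1) = 0 := by
  rw [oddPairing_apply]
  refine Finset.sum_eq_zero fun E hE => ?_
  have : E ≠ D := fun h => hD (h ▸ hE)
  simp [this]

theorem continuous_oddPairing (g : Finset V → ℝ) : Continuous (oddPairing g) :=
  LinearMap.continuous_of_finiteDimensional _

/-- The indicator function of the cuts that contain the edge `uv`. -/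
noncomputable def cutIndicator (u v : V) (D : Finset V) : ℝ := if Separates D u v then 1 else 0

theorem oddPairing_cutIndicator (u v : V) (z : Finset V → ℝ) :
    oddPairing (cutIndicator u v) z = ∑ D ∈ oddSets V with Separates D u v, z D := by
  rw [oddPairing_apply, Finset.sum_filter]
  refine Finset.sum_congr rfl fun D _ => ?_
  unfold cutIndicator
  split_ifs <;> simp

theorem oddPairing_one (z : Finset V → ℝ) :
    oddPairing (fun _ => 1) z = ∑ D ∈ oddSets V, z D := by
  simp [oddPairing_apply]

/-- Nonnegative weights of the odd sets that satisfy the constraints of the dual program. -/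
structure IsPacking (p : V → X) (z : Finset V → ℝ) : Prop where
  nonneg : ∀ D ∈ oddSets V, 0 ≤ z D
  cut_le : ∀ u v, oddPairing (cutIndicator u v) z ≤ dist (p u) (p v)

/-- A packing that is maximal for the total weight, among these minimal for the weighted
cardinality, and among these maximal for the weighted squared cardinality. -/
structure IsExtremalPacking (p : V → X) (z : Finset V → ℝ) : Prop extends IsPacking p z where
  extremal : ∀ z', IsPacking p z' →
    oddPairing (fun _ => 1) z' ≤ oddPairing (fun _ => 1) z ∧
    (oddPairing (fun _ => 1) z' = oddPairing (fun _ => 1) z →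
      oddPairing (fun D => (D.card : ℝ)) z ≤ oddPairing (fun D => (D.card : ℝ)) z' ∧
      (oddPairing (fun D => (D.card : ℝ)) z' = oddPairing (fun D => (D.card : ℝ)) z →
        oddPairing (fun D => (D.card : ℝ) ^ 2) z' ≤ oddPairing (fun D => (D.card : ℝ) ^ 2) z))

/-- The maximizers form a nonempty compact set again, so the lemma can be iterated to optimize
lexicographically. -/
theorem exists_compact_argmax {E : Type*} [TopologicalSpace E] {K : Set E}
    (hK : IsCompact K) (hne : K.Nonempty) {f : E → ℝ} (hf : Continuous f) :
    IsCompact {x ∈ K | ∀ y ∈ K, f y ≤ f x} ∧ {x ∈ K | ∀ y ∈ K, f y ≤ f x}.Nonempty := by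
  obtain ⟨x, hx, hmax⟩ := hK.exists_isMaxOn hne hf.continuousOn
  refine ⟨?_, x, hx, fun y hy => hmax hy⟩
  have : {x ∈ K | ∀ y ∈ K, f y ≤ f x} = K ∩ {y | f x ≤ f y} := by
    ext y
    exact and_congr_right fun hy => ⟨fun h => h x hx, fun h w hw => (hmax hw).trans h⟩
  rw [this]
  exact hK.inter_right (isClosed_le continuous_const hf)

/-- An odd set is crossed by some edge, as the number of all vertices is even. -/
theorem exists_separates (hV : Even (Fintype.card V)) {D : Finset V} (hD : D ∈ oddSets V) :
    ∃ u ∈ D, ∃ v, v ∉ D := by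
  rw [mem_oddSets] at hD
  obtain ⟨u, hu⟩ := Finset.card_pos.1 hD.pos
  refine ⟨u, hu, ?_⟩
  by_contra! h
  rw [Finset.eq_univ_of_forall h, Finset.card_univ] at hD
  exact (Nat.not_odd_iff_even.2 hV) hD

theorem IsPacking.le_dist {p : V → X} {z : Finset V → ℝ} (hz : IsPacking p z) {D : Finset V}
    (hD : D ∈ oddSets V) {u v : V} (h : Separates D u v) : z D ≤ dist (p u) (p v) := by
  refine le_trans ?_ (hz.cut_le u v)
  rw [oddPairing_cutIndicator]
  exact Finset.single_le_sum (f := z) (fun E hE => hz.nonneg E (Finset.mem_filter.1 hE).1)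
    (Finset.mem_filter.2 ⟨hD, h⟩)

theorem exists_isExtremalPacking (hV : Even (Fintype.card V)) (p : V → X) :
    ∃ z, IsExtremalPacking p z := by
  classical
  -- Values off the odd sets are irrelevant; fixing them to `0` makes the feasible set bounded. An
  -- arbitrary competitor is truncated accordingly at the end.
  let K : Set (Finset V → ℝ) := {z | IsPacking p z ∧ ∀ D, D ∉ oddSets V → z D = 0}
  have hKc : IsCompact K := by
    let B : ℝ := ∑ u, ∑ v, dist (p u) (p v)
    have hB : ∀ u v, dist (p u) (p v) ≤ B := fun u v =>
      (Finset.single_le_sum (f := fun v => dist (p u) (p v)) (fun _ _ => dist_nonneg)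
        (Finset.mem_univ v)).trans
      (Finset.single_le_sum (f := fun u => ∑ v, dist (p u) (p v))
        (fun _ _ => Finset.sum_nonneg fun _ _ => dist_nonneg) (Finset.mem_univ u))
    refine (isCompact_univ_pi (s := fun _ : Finset V => Set.Icc 0 B)
      fun _ => isCompact_Icc).of_isClosed_subset ?_ ?_
    · have : K = (⋂ D ∈ oddSets V, {z : Finset V → ℝ | 0 ≤ z D}) ∩
          (⋂ u, ⋂ v, {z : Finset V → ℝ | oddPairing (cutIndicator u v) z ≤ dist (p u) (p v)}) ∩
          ⋂ D ∈ (oddSets V)ᶜ, {z : Finset V → ℝ | z D = 0} := by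
        ext z
        simp only [K, Set.mem_ofPred_eq, Set.mem_inter_iff, Set.mem_iInter, Finset.mem_compl]
        exact ⟨fun h => ⟨⟨h.1.1, h.1.2⟩, h.2⟩, fun h => ⟨⟨h.1.1, h.1.2⟩, h.2⟩⟩
      rw [this]
      refine ((isClosed_biInter fun D _ => ?_).inter
        (isClosed_iInter fun u => isClosed_iInter fun v => ?_)).inter
        (isClosed_biInter fun D _ => ?_)
      · exact isClosed_le continuous_const (continuous_apply D)
      · exact isClosed_le (continuous_oddPairing _) continuous_const
      · exact isClosed_eq (continuous_apply D) continuous_const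
    · intro z hz D _
      have hB0 : 0 ≤ B := Finset.sum_nonneg fun _ _ => Finset.sum_nonneg fun _ _ => dist_nonneg
      by_cases hD : D ∈ oddSets V
      · obtain ⟨u, hu, v, hv⟩ := exists_separates hV hD
        exact ⟨hz.1.nonneg D hD,
          (hz.1.le_dist hD (u := u) (v := v) (by simp [Separates, hu, hv])).trans (hB u v)⟩
      · rw [hz.2 D hD]
        exact ⟨le_rfl, hB0⟩
  have hK0 : K.Nonempty := ⟨0, ⟨fun _ _ => le_rfl, fun u v => by simp⟩, fun _ _ => rfl⟩
  obtain ⟨c1, n1⟩ := exists_compact_argmax hKc hK0 (continuous_oddPairing fun _ => 1)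
  obtain ⟨c2, n2⟩ := exists_compact_argmax c1 n1
    (continuous_oddPairing fun D => (D.card : ℝ)).neg
  obtain ⟨-, z, hz2, hz3⟩ := exists_compact_argmax c2 n2
    (continuous_oddPairing fun D => (D.card : ℝ) ^ 2)
  have hz1 := hz2.1
  refine ⟨z, ⟨hz1.1.1, fun z' hz' => ?_⟩⟩
  let z'' : Finset V → ℝ := fun D => if D ∈ oddSets V then z' D else 0
  have heq : ∀ g, oddPairing g z' = oddPairing g z'' := by
    intro g
    rw [oddPairing_apply, oddPairing_apply]
    exact Finset.sum_congr rfl fun D hD => by simp [z'', hD]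
  have hK'' : z'' ∈ K := by
    refine ⟨⟨fun D hD => ?_, fun u v => ?_⟩, fun D hD => ?_⟩
    · simpa [z'', hD] using hz'.nonneg D hD
    · rw [← heq]
      exact hz'.cut_le u v
    · simp [z'', hD]
  rw [heq, heq, heq]
  refine ⟨hz1.2 _ hK'', fun h1 => ?_⟩
  have m1 : z'' ∈ {x ∈ K | ∀ y ∈ K, oddPairing (fun _ => 1) y ≤ oddPairing (fun _ => 1) x} :=
    ⟨hK'', fun y hy => h1 ▸ hz1.2 y hy⟩
  refine ⟨neg_le_neg_iff.1 (hz2.2 _ m1), fun h2 => hz3 _ ⟨m1, fun y hy => ?_⟩⟩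
  rw [Pi.neg_apply, Pi.neg_apply, h2]
  exact hz2.2 y hy

/-- An extremal packing cannot be improved along a feasible direction. -/
theorem IsExtremalPacking.direction {p : V → X} {z : Finset V → ℝ} (hz : IsExtremalPacking p z)
    (w : Finset V → ℝ) (hw : ∀ D ∈ oddSets V, z D = 0 → 0 ≤ w D)
    (hcut : ∀ u v, oddPairing (cutIndicator u v) z = dist (p u) (p v) →
      oddPairing (cutIndicator u v) w ≤ 0) :
    oddPairing (fun _ => 1) w ≤ 0 ∧ (oddPairing (fun _ => 1) w = 0 →
      0 ≤ oddPairing (fun D => (D.card : ℝ)) w ∧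
      (oddPairing (fun D => (D.card : ℝ)) w = 0 →
        oddPairing (fun D => (D.card : ℝ) ^ 2) w ≤ 0)) := by
  -- A slack constraint survives every small step and a tight one survives a step that does not
  -- increase it. There are finitely many constraints, so one `ε > 0` serves all.
  have key : ∀ a b c : ℝ, (a < c ∨ (a = c ∧ b ≤ 0)) → ∀ᶠ ε in nhdsWithin (0 : ℝ) (Set.Ioi 0),
      a + ε * b ≤ c := by
    rintro a b c (h | ⟨rfl, h⟩)
    · have : Filter.Tendsto (fun ε : ℝ => a + ε * b) (nhdsWithin 0 (Set.Ioi 0))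
          (nhds (a + 0 * b)) := by
        apply Filter.Tendsto.mono_left _ nhdsWithin_le_nhds
        exact (by fun_prop : Continuous fun ε : ℝ => a + ε * b).tendsto 0
      rw [zero_mul, add_zero] at this
      filter_upwards [this.eventually (gt_mem_nhds h)] with ε hε using hε.le
    · filter_upwards [self_mem_nhdsWithin] with ε hε
      have := mul_nonpos_of_nonneg_of_nonpos (Set.mem_Ioi.1 hε).le h
      linarith
  have h1 : ∀ᶠ ε in nhdsWithin (0 : ℝ) (Set.Ioi 0), ∀ D ∈ oddSets V, - z D + ε * (- w D) ≤ 0 := by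
    rw [Filter.eventually_all_finset]
    intro D hD
    apply key
    rcases (hz.nonneg D hD).eq_or_lt with h | h
    · exact Or.inr ⟨by rw [← h, neg_zero], neg_nonpos.2 (hw D hD h.symm)⟩
    · exact Or.inl (by linarith)
  have h2 : ∀ᶠ ε in nhdsWithin (0 : ℝ) (Set.Ioi 0), ∀ u v, oddPairing (cutIndicator u v) z +
      ε * oddPairing (cutIndicator u v) w ≤ dist (p u) (p v) := by
    simp only [Filter.eventually_all]
    intro u v
    apply key
    rcases (hz.cut_le u v).eq_or_lt with h | h
    · exact Or.inr ⟨h, hcut u v h⟩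
    · exact Or.inl h
  obtain ⟨ε, hε1, hε2, hε⟩ := (h1.and (h2.and self_mem_nhdsWithin)).exists
  have hε : 0 < ε := hε
  have hp : IsPacking p (z + ε • w) := by
    refine ⟨fun D hD => ?_, fun u v => ?_⟩
    · have := hε1 D hD
      simp only [Pi.add_apply, Pi.smul_apply, smul_eq_mul]
      linarith
    · simpa using hε2 u v
  have hex := hz.extremal _ hp
  simp only [map_add, map_smul, smul_eq_mul, add_le_iff_nonpos_right, add_eq_left,
    mul_eq_zero, hε.ne', false_or, le_add_iff_nonneg_right] at hex
  refine ⟨nonpos_of_mul_nonpos_right hex.1 hε, fun h => ?_⟩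
  have hex := hex.2 h
  refine ⟨nonneg_of_mul_nonneg_right hex.1 hε, fun h => ?_⟩
  exact nonpos_of_mul_nonpos_right (hex.2 h) hε

/-- The odd sets of positive weight, together with the single vertices. -/
noncomputable def moatFamily (z : Finset V → ℝ) : Finset (Finset V) :=
  open Classical in {D ∈ oddSets V | D.card = 1 ∨ 0 < z D}

theorem mem_moatFamily {z : Finset V → ℝ} {D : Finset V} :
    D ∈ moatFamily z ↔ D ∈ oddSets V ∧ (D.card = 1 ∨ 0 < z D) := by
  simp [moatFamily]

theorem IsExtremalPacking.laminar {p : V → X} {z : Finset V → ℝ}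
    (hz : IsExtremalPacking p z) {D T : Finset V} (hD : D ∈ moatFamily z)
    (hT : T ∈ moatFamily z) : D ⊆ T ∨ T ⊆ D ∨ Disjoint D T := by
  rw [mem_moatFamily] at hD hT
  by_contra! hcon
  obtain ⟨hDT, hTD, hdis⟩ := hcon
  -- A single vertex cannot cross another set, so both sets have positive weight and can be lowered.
  have hD1 : 0 < z D := by
    refine hD.2.resolve_left fun h => ?_
    obtain ⟨a, rfl⟩ := Finset.card_eq_one.1 h
    rw [Finset.singleton_subset_iff] at hDT
    exact hdis (Finset.disjoint_singleton_left.2 hDT)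
  have hT1 : 0 < z T := by
    refine hT.2.resolve_left fun h => ?_
    obtain ⟨a, rfl⟩ := Finset.card_eq_one.1 h
    rw [Finset.singleton_subset_iff] at hTD
    exact hdis (Finset.disjoint_singleton_right.2 hTD)
  have c1 := Finset.card_inter_add_card_sdiff D T
  have c2 := Finset.card_inter_add_card_sdiff T D
  rw [Finset.inter_comm T D] at c2
  have c3 := Finset.card_union_add_card_inter D T
  have i1 : 0 < (D ∩ T).card := Finset.card_pos.2 (Finset.not_disjoint_iff_nonempty_inter.1 hdis)
  have i2 : 0 < (D \ T).card := Finset.card_pos.2 (Finset.sdiff_nonempty.2 hDT)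
  have i3 : 0 < (T \ D).card := Finset.card_pos.2 (Finset.sdiff_nonempty.2 hTD)
  -- exchanging `D`, `T` for two other odd sets `A`, `B`
  have step : ∀ A B : Finset V, A ∈ oddSets V → B ∈ oddSets V →
      (∀ u v, cutIndicator u v A + cutIndicator u v B ≤ cutIndicator u v D + cutIndicator u v T) →
      (D.card : ℝ) + T.card ≤ A.card + B.card ∧ ((A.card : ℝ) + B.card = D.card + T.card →
        (A.card : ℝ) ^ 2 + (B.card : ℝ) ^ 2 ≤ (D.card : ℝ) ^ 2 + (T.card : ℝ) ^ 2) := by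
    intro A B hA hB hcut
    have := hz.direction (Pi.single A 1 + Pi.single B 1 - Pi.single D 1 - Pi.single T 1) ?_ ?_
    · simp only [map_add, map_sub, oddPairing_single _ _ hA, oddPairing_single _ _ hB,
        oddPairing_single _ _ hD.1, oddPairing_single _ _ hT.1] at this
      obtain ⟨h1, h2⟩ := this.2 (by norm_num)
      exact ⟨by linarith, fun h => by linarith [h2 (by linarith)]⟩
    · intro E _ hE
      have e1 : E ≠ D := fun h => hD1.ne' (h ▸ hE)
      have e2 : E ≠ T := fun h => hT1.ne' (h ▸ hE)
      have s : ∀ C : Finset V, 0 ≤ (Pi.single C 1 : Finset V → ℝ) E := fun C =>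
        (Pi.single_nonneg.2 zero_le_one : (0 : Finset V → ℝ) ≤ Pi.single C 1) E
      simp only [Pi.sub_apply, Pi.add_apply, Pi.single_eq_of_ne e1, Pi.single_eq_of_ne e2,
        sub_zero]
      exact add_nonneg (s A) (s B)
    · intro u v _
      simp only [map_add, map_sub, oddPairing_single _ _ hA, oddPairing_single _ _ hB,
        oddPairing_single _ _ hD.1, oddPairing_single _ _ hT.1]
      linarith [hcut u v]
  have oD := mem_oddSets.1 hD.1
  have oT := mem_oddSets.1 hT.1
  -- The total weight is kept in both exchanges. If the intersection is even, the two differences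
  -- are odd and have smaller total cardinality. If it is odd, intersection and union are odd with
  -- the same total cardinality, and the sum of squares grows by `2 (|D| - |D ∩ T|) (|T| - |D ∩ T|)
  -- > 0`.
  rcases Nat.even_or_odd (D ∩ T).card with he | ho
  · have := (step (D \ T) (T \ D) (mem_oddSets.2 ?_) (mem_oddSets.2 ?_) ?_).1
    · norm_cast at this
      omega
    · rw [← c1] at oD
      exact (Nat.odd_add'.1 oD).2 he
    · rw [← c2] at oT
      exact (Nat.odd_add'.1 oT).2 he
    · intro u v
      unfold cutIndicator Separates
      simp only [Finset.mem_sdiff]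
      by_cases h1 : u ∈ D <;> by_cases h2 : u ∈ T <;> by_cases h3 : v ∈ D <;>
        by_cases h4 : v ∈ T <;> simp [h1, h2, h3, h4]
  · have := (step (D ∩ T) (D ∪ T) (mem_oddSets.2 ho) (mem_oddSets.2 ?_) ?_).2 ?_
    · have h1 : ((D ∪ T).card : ℝ) = D.card + T.card - (D ∩ T).card := by
        rw [eq_sub_iff_add_eq]
        exact_mod_cast c3
      have h2 : ((D ∩ T).card : ℝ) < D.card := by exact_mod_cast (by omega)
      have h3 : ((D ∩ T).card : ℝ) < T.card := by exact_mod_cast (by omega)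
      rw [h1] at this
      nlinarith [mul_pos (sub_pos.2 h2) (sub_pos.2 h3)]
    · have := oD.add_odd oT
      rw [← c3] at this
      by_contra hne
      exact (Nat.not_odd_iff_even.2 this) ((Nat.not_odd_iff_even.1 hne).add_odd ho)
    · intro u v
      unfold cutIndicator Separates
      simp only [Finset.mem_inter, Finset.mem_union]
      by_cases h1 : u ∈ D <;> by_cases h2 : u ∈ T <;> by_cases h3 : v ∈ D <;>
        by_cases h4 : v ∈ T <;> simp [h1, h2, h3, h4]
    · norm_cast
      omega

end
-- Laminar packings, children, and tight edges
section
variable {X V : Type*} [MetricSpace X] [Fintype V] [DecidableEq V]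

/-- A packing which, apart from single vertices, is positive exactly on the laminar family `H`. -/
structure IsLaminarPacking (p : V → X) (z : Finset V → ℝ) (H : Finset (Finset V)) : Prop
    extends IsPacking p z where
  odd : H ⊆ oddSets V
  laminar : ∀ D ∈ H, ∀ T ∈ H, D ⊆ T ∨ T ⊆ D ∨ Disjoint D T
  singleton_mem : ∀ v, {v} ∈ H
  pos_iff : ∀ D ∈ oddSets V, D.card ≠ 1 → (0 < z D ↔ D ∈ H)

theorem IsExtremalPacking.isLaminarPacking {p : V → X} {z : Finset V → ℝ}
    (hz : IsExtremalPacking p z) : IsLaminarPacking p z (moatFamily z) where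
  toIsPacking := hz.toIsPacking
  odd D hD := (mem_moatFamily.1 hD).1
  laminar _ hD _ hT := hz.laminar hD hT
  singleton_mem v := mem_moatFamily.2 ⟨mem_oddSets.2 (by simp), Or.inl (by simp)⟩
  pos_iff D hD h := by simp [mem_moatFamily, hD, h]

theorem IsLaminarPacking.mem_of_pos {p : V → X} {z : Finset V → ℝ} {H : Finset (Finset V)}
    (h : IsLaminarPacking p z H) {D : Finset V} (hD : D ∈ oddSets V) (hz : 0 < z D) : D ∈ H := by
  by_cases h1 : D.card = 1
  · obtain ⟨v, rfl⟩ := Finset.card_eq_one.1 h1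
    exact h.singleton_mem v
  · exact (h.pos_iff D hD h1).1 hz

theorem IsLaminarPacking.nonneg' {p : V → X} {z : Finset V → ℝ} {H : Finset (Finset V)}
    (h : IsLaminarPacking p z H) {D : Finset V} (hD : D ∈ H) : 0 ≤ z D :=
  h.nonneg D (h.odd hD)

theorem IsLaminarPacking.oddPairing_eq {p : V → X} {z : Finset V → ℝ} {H : Finset (Finset V)}
    (h : IsLaminarPacking p z H) (g : Finset V → ℝ) :
    oddPairing g z = ∑ D ∈ H, g D * z D := by
  rw [oddPairing_apply]
  refine (Finset.sum_subset h.odd fun D hD hDH => ?_).symm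
  have : z D = 0 := by
    by_contra hne
    exact hDH (h.mem_of_pos hD ((h.nonneg D hD).lt_of_ne' hne))
  rw [this, mul_zero]

theorem IsLaminarPacking.cut_eq {p : V → X} {z : Finset V → ℝ} {H : Finset (Finset V)}
    (h : IsLaminarPacking p z H) (u v : V) :
    oddPairing (cutIndicator u v) z = ∑ D ∈ H with Separates D u v, z D := by
  rw [h.oddPairing_eq, Finset.sum_filter]
  refine Finset.sum_congr rfl fun D _ => ?_
  unfold cutIndicator
  split_ifs <;> simp

/-- The maximal members of `H` that are properly contained in `D`. -/
def children (H : Finset (Finset V)) (D : Finset V) : Finset (Finset V) :=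
  {C ∈ H | C ⊂ D ∧ ∀ T ∈ H, T ⊂ D → C ⊆ T → T = C}

theorem mem_children {H : Finset (Finset V)} {C D : Finset V} :
    C ∈ children H D ↔ C ∈ H ∧ C ⊂ D ∧ ∀ T ∈ H, T ⊂ D → C ⊆ T → T = C := by
  simp [children]

theorem exists_child {H : Finset (Finset V)} {D E : Finset V} (hE : E ∈ H) (hED : E ⊂ D) :
    ∃ C ∈ children H D, E ⊆ C := by
  obtain ⟨C, hEC, hC⟩ := Finset.exists_le_maximal ({T ∈ H | T ⊂ D} : Finset (Finset V))
    (Finset.mem_filter.2 ⟨hE, hED⟩)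
  refine ⟨C, ?_, hEC⟩
  obtain ⟨h1, h2⟩ := Finset.mem_filter.1 hC.prop
  exact mem_children.2 ⟨h1, h2, fun T hT hTD hCT =>
    le_antisymm (hC.le_of_ge (Finset.mem_filter.2 ⟨hT, hTD⟩) hCT) hCT⟩

theorem IsLaminarPacking.children_disjoint {p : V → X} {z : Finset V → ℝ}
    {H : Finset (Finset V)} (h : IsLaminarPacking p z H) {C C' D : Finset V}
    (hC : C ∈ children H D) (hC' : C' ∈ children H D) (hne : C ≠ C') : Disjoint C C' := by
  rw [mem_children] at hC hC'
  rcases h.laminar C hC.1 C' hC'.1 with h1 | h1 | h1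
  · exact (hne (hC.2.2 C' hC'.1 hC'.2.1 h1).symm).elim
  · exact (hne (hC'.2.2 C hC.1 hC.2.1 h1)).elim
  · exact h1

theorem IsLaminarPacking.child_unique {p : V → X} {z : Finset V → ℝ}
    {H : Finset (Finset V)} (h : IsLaminarPacking p z H) {C C' D : Finset V}
    (hC : C ∈ children H D) (hC' : C' ∈ children H D) {u : V} (hu : u ∈ C) (hu' : u ∈ C') :
    C = C' := by
  by_contra hne
  exact Finset.disjoint_left.1 (h.children_disjoint hC hC' hne) hu hu'

theorem IsLaminarPacking.exists_child_mem {p : V → X} {z : Finset V → ℝ}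
    {H : Finset (Finset V)} (h : IsLaminarPacking p z H) {D : Finset V} (hD : D.card ≠ 1)
    {u : V} (hu : u ∈ D) : ∃ C ∈ children H D, u ∈ C := by
  obtain ⟨C, hC, huC⟩ := exists_child (D := D) (h.singleton_mem u)
    ((Finset.singleton_subset_iff.2 hu).ssubset_of_ne fun h => hD (by rw [← h]; simp))
  exact ⟨C, hC, huC (Finset.mem_singleton_self u)⟩

theorem IsLaminarPacking.biUnion_children {p : V → X} {z : Finset V → ℝ}
    {H : Finset (Finset V)} (h : IsLaminarPacking p z H) {D : Finset V} (hD : D.card ≠ 1) :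
    (children H D).biUnion id = D := by
  ext u
  simp only [Finset.mem_biUnion, id]
  constructor
  · rintro ⟨C, hC, hu⟩
    exact (mem_children.1 hC).2.1.1 hu
  · intro hu
    exact h.exists_child_mem hD hu

/-- The members of `H` that separate vertices of two different children of `D`. -/
theorem IsLaminarPacking.separates_iff {p : V → X} {z : Finset V → ℝ}
    {H : Finset (Finset V)} (h : IsLaminarPacking p z H) {D : Finset V}
    (hD : ∀ E ∈ H, E ⊆ D ∨ D ⊆ E ∨ Disjoint E D) {C C' : Finset V} (hC : C ∈ children H D)
    (hC' : C' ∈ children H D) (hne : C ≠ C') {u w : V} (hu : u ∈ C) (hw : w ∈ C')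
    {E : Finset V} (hE : E ∈ H) :
    Separates E u w ↔ (u ∈ E ∧ E ⊆ C) ∨ (w ∈ E ∧ E ⊆ C') := by
  have hdis := Finset.disjoint_left.1 (h.children_disjoint hC hC' hne)
  -- A member that contains `u` but not `w` meets `D` without containing it, so it lies properly in
  -- `D` and hence in a single child.
  have key : ∀ {C C' : Finset V}, C ∈ children H D → C' ∈ children H D → ∀ {u w : V}, u ∈ C →
      w ∈ C' → u ∈ E → w ∉ E → E ⊆ C := by
    intro C C' hC hC' u w hu hw huE hwE
    have hwD := (mem_children.1 hC').2.1.1 hw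
    have huD := (mem_children.1 hC).2.1.1 hu
    have hED : E ⊂ D := by
      rcases hD E hE with h1 | h1 | h1
      · exact h1.ssubset_of_ne fun h => hwE (h ▸ hwD)
      · exact (hwE (h1 hwD)).elim
      · exact (Finset.disjoint_left.1 h1 huE huD).elim
    obtain ⟨C'', hC'', hEC⟩ := exists_child hE hED
    rwa [h.child_unique hC hC'' hu (hEC huE)]
  unfold Separates
  constructor
  · intro hsep
    by_cases huE : u ∈ E
    · have hwE : w ∉ E := fun hw => hsep ⟨fun _ => hw, fun _ => huE⟩
      exact Or.inl ⟨huE, key hC hC' hu hw huE hwE⟩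
    · have hwE : w ∈ E := by
        by_contra hwE
        exact hsep ⟨fun h => (huE h).elim, fun h => (hwE h).elim⟩
      exact Or.inr ⟨hwE, key hC' hC hw hu hwE huE⟩
  · rintro (⟨h1, h2⟩ | ⟨h1, h2⟩) hiff
    · exact hdis (h2 (hiff.1 h1)) hw
    · exact hdis hu (h2 (hiff.2 h1))

/-- The edge `uv` satisfies its constraint with equality. -/
def IsTight (p : V → X) (z : Finset V → ℝ) (u v : V) : Prop :=
  oddPairing (cutIndicator u v) z = dist (p u) (p v)

theorem cutIndicator_comm {V : Type*} [DecidableEq V] (u v : V) :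
    cutIndicator u v = cutIndicator v u := by
  ext D
  exact if_congr (not_congr iff_comm) rfl rfl

theorem cutIndicator_eq_one {V : Type*} [DecidableEq V] {u v : V} {D : Finset V}
    (h : Separates D u v) :
    cutIndicator u v D = 1 := if_pos h

theorem cutIndicator_eq_zero {V : Type*} [DecidableEq V] {u v : V} {D : Finset V}
    (h : ¬ Separates D u v) :
    cutIndicator u v D = 0 := if_neg h

theorem IsTight.symm {p : V → X} {z : Finset V → ℝ} {u v : V} (h : IsTight p z u v) :
    IsTight p z v u := by
  unfold IsTight
  rw [cutIndicator_comm, dist_comm]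
  exact h

theorem cutIndicator_nonneg {V : Type*} [DecidableEq V] (u v : V) (D : Finset V) :
    0 ≤ cutIndicator u v D := by
  unfold cutIndicator
  split_ifs <;> norm_num

/-- A child that is a single vertex of weight zero transmits tightness, by the triangle
inequality. -/
theorem IsLaminarPacking.isTight_of_zero {p : V → X} {z : Finset V → ℝ}
    {H : Finset (Finset V)} (h : IsLaminarPacking p z H) {D : Finset V}
    (hD : ∀ E ∈ H, E ⊆ D ∨ D ⊆ E ∨ Disjoint E D) {C C' : Finset V} (hC : C ∈ children H D)
    (hC' : C' ∈ children H D) (hne : C ≠ C') {u v w : V} (hu : u ∈ C) (hw : w ∈ C')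
    (hv : {v} ∈ children H D) (hv0 : z {v} = 0) (huv : IsTight p z u v) (hvw : IsTight p z v w) :
    IsTight p z u w := by
  refine le_antisymm (h.cut_le u w) ?_
  refine (dist_triangle _ (p v) _).trans ?_
  rw [← huv, ← hvw, h.oddPairing_eq, h.oddPairing_eq, h.oddPairing_eq, ← Finset.sum_add_distrib]
  refine Finset.sum_le_sum fun E hE => ?_
  rw [← add_mul]
  rcases (h.nonneg' hE).eq_or_lt with h0 | h0
  · simp [← h0]
  refine mul_le_mul_of_nonneg_right ?_ h0.le
  have huD := (mem_children.1 hC).2.1.1 hu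
  have hwD := (mem_children.1 hC').2.1.1 hw
  have hvD := (mem_children.1 hv).2.1.1 (Finset.mem_singleton_self v)
  -- For sets of positive weight, the cuts between `u` and `v` and between `v` and `w` together cost
  -- no more than the cut between `u` and `w`. A set of positive weight that contains `v` must
  -- contain all of `D`, since `{v}` is a child of weight zero, and so separates none of the pairs.
  by_cases hvE : v ∈ E
  · have hDE : D ⊆ E := by
      by_contra hDE
      have hED : E ⊂ D := by
        rcases hD E hE with h1 | h1 | h1
        · exact ⟨h1, hDE⟩
        · exact (hDE h1).elim
        · exact (Finset.disjoint_left.1 h1 hvE hvD).elim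
      have := (mem_children.1 hv).2.2 E hE hED (Finset.singleton_subset_iff.2 hvE)
      rw [this, hv0] at h0
      exact lt_irrefl _ h0
    simp [cutIndicator, Separates, hDE huD, hDE hwD, hvE]
  -- A set avoiding `v` but containing `u` and `w` would lie in one child, whereas `u` and `w` lie
  -- in different ones.
  · have : ¬ (u ∈ E ∧ w ∈ E) := by
      rintro ⟨huE, hwE⟩
      have hED : E ⊂ D := by
        rcases hD E hE with h1 | h1 | h1
        · exact h1.ssubset_of_ne fun h => hvE (h ▸ hvD)
        · exact (hvE (h1 hvD)).elim
        · exact (Finset.disjoint_left.1 h1 huE huD).elim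
      obtain ⟨C'', hC'', hEC⟩ := exists_child hE hED
      exact hne ((h.child_unique hC hC'' hu (hEC huE)).trans
        (h.child_unique hC' hC'' hw (hEC hwE)).symm)
    by_cases h1 : u ∈ E <;> by_cases h2 : w ∈ E <;>
      simp_all [cutIndicator, Separates]

/-- Raising the weights of odd unions of children of `D` and lowering the weights of other
children and of `D` does not improve an extremal packing. -/
theorem IsExtremalPacking.barrier_le {p : V → X} {z : Finset V → ℝ}
    (hz : IsExtremalPacking p z) {D : Finset V} (hV : Even (Fintype.card V))
    (hD1 : D.card ≠ 1) (hD : D = Finset.univ ∨ D ∈ moatFamily z)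
    {A : Finset (Finset V)} {𝒞 : Finset (Finset (Finset V))}
    (hA : A ⊆ children (moatFamily z) D) (hApos : ∀ a ∈ A, 0 < z a)
    (hC : ∀ C ∈ 𝒞, C ⊆ children (moatFamily z) D) (hCA : ∀ C ∈ 𝒞, Disjoint C A)
    (hCodd : ∀ C ∈ 𝒞, Odd C.card) (hdis : ∀ C ∈ 𝒞, ∀ C' ∈ 𝒞, C ≠ C' → Disjoint C C')
    (htight : ∀ C ∈ 𝒞, ∀ c ∈ C, ∀ b ∈ children (moatFamily z) D, b ∉ C → b ∉ A →
      ∀ u ∈ c, ∀ v ∈ b, ¬ IsTight p z u v) :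
    𝒞.card ≤ A.card + (if D ∈ oddSets V then 1 else 0) ∧
      (𝒞.card = A.card + (if D ∈ oddSets V then 1 else 0) →
        (if D ∈ oddSets V then D.card else 0) ≤ ∑ C ∈ 𝒞, (C.biUnion id).card) := by
  have hL := hz.isLaminarPacking
  set H := moatFamily z with hH
  have huniv : (Finset.univ : Finset V) ∉ oddSets V := by
    rw [mem_oddSets, Finset.card_univ]
    exact Nat.not_odd_iff_even.2 hV
  have hUodd : ∀ C ∈ 𝒞, C.biUnion id ∈ oddSets V := by
    intro C hC'
    have hcard := Finset.card_biUnion (s := C) (t := id) fun a ha b hb hab =>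
      hL.children_disjoint (hC C hC' ha) (hC C hC' hb) hab
    rw [mem_oddSets, hcard, Finset.odd_sum_iff_odd_card_odd, Finset.filter_true_of_mem]
    · exact hCodd C hC'
    · intro a ha
      exact mem_oddSets.1 (hL.odd (mem_children.1 (hC C hC' ha)).1)
  have hAodd : ∀ a ∈ A, a ∈ oddSets V := fun a ha => hL.odd (mem_children.1 (hA ha)).1
  -- The last term has no effect when `D` is the whole vertex set, which is even; this is why `D` is
  -- counted only if odd.
  let w : Finset V → ℝ := ∑ C ∈ 𝒞, Pi.single (C.biUnion id) 1 - ∑ a ∈ A, Pi.single a 1 -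
    Pi.single D 1
  have hw : ∀ g, oddPairing g w = ∑ C ∈ 𝒞, g (C.biUnion id) - ∑ a ∈ A, g a -
      (if D ∈ oddSets V then g D else 0) := by
    intro g
    simp only [w, map_sub, map_sum]
    congr 1
    · congr 1
      · exact Finset.sum_congr rfl fun C hC => oddPairing_single g _ (hUodd C hC)
      · exact Finset.sum_congr rfl fun a ha => oddPairing_single g _ (hAodd a ha)
    · split_ifs with h
      · exact oddPairing_single g _ h
      · exact oddPairing_single_of_notMem g _ h
  have hdir := hz.direction w ?_ ?_
  · rw [hw, hw] at hdir
    simp only [Finset.sum_const, nsmul_eq_mul, mul_one] at hdir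
    obtain ⟨h1, h2⟩ := hdir
    -- In the case of equality the total weight is unchanged, so the cardinality criterion applies;
    -- the cardinalities from `A` are dropped from its conclusion.
    have hAs : (0 : ℝ) ≤ ∑ a ∈ A, (a.card : ℝ) := Finset.sum_nonneg fun _ _ => Nat.cast_nonneg _
    split_ifs at h1 h2 ⊢
    · refine ⟨?_, fun h => ?_⟩
      · have : (𝒞.card : ℝ) ≤ A.card + 1 := by linarith
        exact_mod_cast this
      · have h' : (𝒞.card : ℝ) = A.card + 1 := by exact_mod_cast h
        have := (h2 (by linarith)).1
        have : (D.card : ℝ) ≤ ∑ C ∈ 𝒞, ((C.biUnion id).card : ℝ) := by linarith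
        exact_mod_cast this
    · refine ⟨?_, fun _ => Nat.zero_le _⟩
      have : (𝒞.card : ℝ) ≤ A.card := by linarith
      exact_mod_cast this
  · intro E hE hE0
    have s : ∀ C : Finset V, 0 ≤ (Pi.single C 1 : Finset V → ℝ) E := fun C =>
      (Pi.single_nonneg.2 zero_le_one : (0 : Finset V → ℝ) ≤ Pi.single C 1) E
    have e1 : E ≠ D := by
      rintro rfl
      rcases hD with rfl | hD
      · exact huniv hE
      · exact ((mem_moatFamily.1 hD).2.resolve_left hD1).ne' hE0
    simp only [w, Pi.sub_apply, Finset.sum_apply, Pi.single_eq_of_ne e1, sub_zero]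
    rw [Finset.sum_eq_zero (s := A), sub_zero]
    · exact Finset.sum_nonneg fun C _ => s _
    · intro a ha
      have hEa : E ≠ a := by
        rintro rfl
        exact (hApos E ha).ne' hE0
      exact Pi.single_eq_of_ne hEa _
  · intro u v huv
    rw [hw, sub_sub, sub_nonpos]
    have hAn : ∀ u v, 0 ≤ ∑ a ∈ A, cutIndicator u v a :=
      fun u v => Finset.sum_nonneg fun a _ => cutIndicator_nonneg u v a
    have hDn : ∀ u v, 0 ≤ (if D ∈ oddSets V then cutIndicator u v D else 0) := by
      intro u v
      split_ifs
      · exact cutIndicator_nonneg u v D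
      · exact le_rfl
    have hUD : ∀ C ∈ 𝒞, C.biUnion id ⊆ D := by
      intro C hC' x hx
      obtain ⟨c, hc, hx⟩ := Finset.mem_biUnion.1 hx
      exact (mem_children.1 (hC C hC' hc)).2.1.1 hx
    -- A tight edge leaving a raised union ends in a lowered child from `A` or leaves `D`. In either
    -- case it crosses only one raised union, and a lowered set pays for it.
    have main : ∀ u v, IsTight p z u v → ∀ C₀ ∈ 𝒞, u ∈ C₀.biUnion id → v ∉ C₀.biUnion id →
        ∑ C ∈ 𝒞, cutIndicator u v (C.biUnion id) ≤
          ∑ a ∈ A, cutIndicator u v a + (if D ∈ oddSets V then cutIndicator u v D else 0) := by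
      intro u v huv C₀ hC₀ hu hv
      obtain ⟨c, hc, huc⟩ := Finset.mem_biUnion.1 hu
      change u ∈ c at huc
      have hucC : ∀ C ∈ 𝒞, C ≠ C₀ → u ∉ C.biUnion id := by
        intro C hC' hne hu'
        obtain ⟨c', hc', huc'⟩ := Finset.mem_biUnion.1 hu'
        have := hL.child_unique (hC _ hC₀ hc) (hC _ hC' hc') huc huc'
        exact Finset.disjoint_left.1 (hdis C hC' C₀ hC₀ hne) hc' (this ▸ hc)
      have hone : (∀ C ∈ 𝒞, v ∉ C.biUnion id) →
          ∑ C ∈ 𝒞, cutIndicator u v (C.biUnion id) ≤ 1 := by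
        intro hv'
        rw [Finset.sum_eq_single_of_mem C₀ hC₀]
        · unfold cutIndicator
          split_ifs <;> norm_num
        · intro C hC' hne
          exact cutIndicator_eq_zero
            (not_not.2 (iff_of_false (hucC C hC' hne) (hv' C hC')))
      by_cases hvD : v ∈ D
      · obtain ⟨b, hb, hvb⟩ := hL.exists_child_mem hD1 hvD
        have hbC : b ∉ C₀ := fun h => hv (Finset.mem_biUnion.2 ⟨b, h, hvb⟩)
        have hbA : b ∈ A := by
          by_contra hbA
          exact htight C₀ hC₀ c hc b hb hbC hbA u huc v hvb huv
        have hub : u ∉ b := fun h =>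
          hbC (hL.child_unique (hC _ hC₀ hc) hb huc h ▸ hc)
        have h1 : 1 ≤ ∑ a ∈ A, cutIndicator u v a := by
          refine le_trans ?_ (Finset.single_le_sum
            (fun a _ => cutIndicator_nonneg u v a) hbA)
          simp [cutIndicator, Separates, hub, hvb]
        have h2 := hone fun C hC' hvC => by
          obtain ⟨b', hb', hvb'⟩ := Finset.mem_biUnion.1 hvC
          have := hL.child_unique hb (hC _ hC' hb') hvb hvb'
          exact Finset.disjoint_left.1 (hCA C hC') hb' (this ▸ hbA)
        linarith [hDn u v]
      · have hDo : D ∈ oddSets V := by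
          rcases hD with rfl | hD
          · exact (hvD (Finset.mem_univ v)).elim
          · exact hL.odd hD
        have h2 := hone fun C hC' hvC => hvD (hUD C hC' hvC)
        have h3 : cutIndicator u v D = 1 := by
          simp [cutIndicator, Separates, hUD C₀ hC₀ hu, hvD]
        rw [if_pos hDo, h3]
        linarith [hAn u v]
    by_cases hex : ∃ C₀ ∈ 𝒞, Separates (C₀.biUnion id) u v
    · obtain ⟨C₀, hC₀, hsep⟩ := hex
      by_cases hu : u ∈ C₀.biUnion id
      · exact main u v huv C₀ hC₀ hu fun hv => hsep ⟨fun _ => hv, fun _ => hu⟩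
      · have hv : v ∈ C₀.biUnion id := by
          by_contra hv
          exact hsep ⟨fun h => (hu h).elim, fun h => (hv h).elim⟩
        rw [cutIndicator_comm]
        exact main v u (IsTight.symm huv) C₀ hC₀ hv hu
    · push Not at hex
      rw [Finset.sum_eq_zero]
      · exact add_nonneg (hAn u v) (hDn u v)
      · intro C hC'
        simp [cutIndicator, hex C hC']

end

/-! ### Tight matchings built down the laminar tree -/

/-- Both partners must use the same witnessing pair. An auxiliary linear order lets the smaller of
`c` and `m c` choose it for both. -/
theorem exists_involution_choice {α β : Type*} [Nonempty β] (S : Finset α) (m : α → α)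
    (hm : ∀ c ∈ S, m c ∈ S ∧ m (m c) = c ∧ m c ≠ c) (T : α → α → β → β → Prop)
    (hT : ∀ a b u v, T a b u v → T b a v u) (hex : ∀ c ∈ S, ∃ u v, T c (m c) u v) :
    ∃ x : α → β, ∀ c ∈ S, T c (m c) (x c) (x (m c)) := by
  classical
  let : LinearOrder α := linearOrderOfSTO WellOrderingRel
  have hex' : ∀ c, ∃ u v, c ∈ S → T c (m c) u v := by
    intro c
    by_cases hc : c ∈ S
    · obtain ⟨u, v, h⟩ := hex c hc
      exact ⟨u, v, fun _ => h⟩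
    · exact ⟨Classical.arbitrary β, Classical.arbitrary β, fun h => (hc h).elim⟩
  choose f g hfg using hex'
  refine ⟨fun c => if c < m c then f c else g (m c), fun c hc => ?_⟩
  obtain ⟨h1, h2, h3⟩ := hm c hc
  simp only [h2]
  rcases lt_or_gt_of_ne h3 with h | h
  · rw [if_neg h.not_gt, if_pos h]
    have := hfg (m c) h1
    rw [h2] at this
    exact hT _ _ _ _ this
  · rw [if_pos h, if_neg h.not_gt]
    exact hfg c hc

section
variable {X V : Type*} [MetricSpace X] [Fintype V] [DecidableEq V]

theorem IsExtremalPacking.mem_or_univ_laminar {p : V → X} {z : Finset V → ℝ}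
    (hz : IsExtremalPacking p z) {D : Finset V} (hD : D = Finset.univ ∨ D ∈ moatFamily z) :
    ∀ E ∈ moatFamily z, E ⊆ D ∨ D ⊆ E ∨ Disjoint E D := by
  intro E hE
  rcases hD with rfl | hD
  · exact Or.inl (Finset.subset_univ E)
  · exact hz.laminar hE hD

/-- The children of `D` that avoid `F` are perfectly matched by tight edges. -/
theorem IsExtremalPacking.exists_child_matching {p : V → X} {z : Finset V → ℝ}
    (hz : IsExtremalPacking p z) {D : Finset V} (hV : Even (Fintype.card V))
    (hD1 : D.card ≠ 1) (hD : D = Finset.univ ∨ D ∈ moatFamily z) {F : Finset V}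
    (hFD : F ⊆ D) (hF : F.card ≤ 1) (hpar : Even (D.card + F.card)) :
    ∃ m : Finset V → Finset V, ∀ c ∈ {c ∈ children (moatFamily z) D | Disjoint c F},
      m c ∈ {c ∈ children (moatFamily z) D | Disjoint c F} ∧ m (m c) = c ∧ m c ≠ c ∧
      ∃ u ∈ c, ∃ v ∈ m c, IsTight p z u v := by
  classical
  have hL := hz.isLaminarPacking
  have hDL := hz.mem_or_univ_laminar hD
  set H := moatFamily z with hH
  set S : Finset (Finset V) := {c ∈ children H D | Disjoint c F} with hS
  set Q : Finset (Finset V) := {c ∈ children H D | ¬ Disjoint c F} with hQ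
  have hQF : Q.card = F.card := by
    rcases Nat.le_one_iff_eq_zero_or_eq_one.1 hF with h | h
    · rw [Finset.card_eq_zero] at h
      simp [hQ, h]
    · obtain ⟨v, rfl⟩ := Finset.card_eq_one.1 h
      obtain ⟨c, hc, hvc⟩ := hL.exists_child_mem hD1 (hFD (Finset.mem_singleton_self v))
      have : Q = {c} := by
        ext c'
        simp only [hQ, Finset.mem_filter, Finset.mem_singleton, Finset.disjoint_singleton_right,
          not_not]
        constructor
        · rintro ⟨h1, h2⟩
          exact hL.child_unique h1 hc h2 hvc
        · rintro rfl
          exact ⟨hc, hvc⟩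
      rw [this]
      simp
  have hchildren : Odd D.card ↔ Odd (children H D).card := by
    have h1 := Finset.card_biUnion (s := children H D) (t := id) fun a ha b hb hab =>
      hL.children_disjoint ha hb hab
    rw [hL.biUnion_children hD1] at h1
    rw [h1, Finset.odd_sum_iff_odd_card_odd, Finset.filter_true_of_mem]
    intro a ha
    exact mem_oddSets.1 (hL.odd (mem_children.1 ha).1)
  have hSQ : S.card + Q.card = (children H D).card :=
    Finset.card_filter_add_card_filter_not _
  have hSeven : Even S.card := by
    rw [hQF] at hSQ
    rw [← hSQ] at hchildren
    by_contra hodd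
    rw [Nat.not_even_iff_odd] at hodd
    simp only [Nat.odd_iff, Nat.even_iff] at hchildren hpar hodd
    omega
  obtain h | ⟨A₀, 𝒞₀, hA₀, h𝒞₀, hdis, hcard⟩ := exists_involution_or_barrier S
    (fun c b => ∃ u ∈ c, ∃ v ∈ b, IsTight p z u v)
    (fun c b ⟨u, hu, v, hv, h⟩ => ⟨v, hv, u, hu, h.symm⟩) hSeven
  · exact h
  exfalso
  -- The child that meets `F` joins the barrier. Members of weight zero cannot be lowered, so they
  -- are discarded together with the components tightly joined to them; this leaves `|𝒞| ≥ |A| + 2 -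
  -- |F|`.
  let A₁ := A₀ ∪ Q
  have hA₁ : A₁ ⊆ children H D := Finset.union_subset
    (hA₀.trans (Finset.filter_subset _ _)) (Finset.filter_subset _ _)
  let A := A₁.filter fun a => 0 < z a
  let Z := A₁.filter fun a => ¬ 0 < z a
  let adj : Finset (Finset V) → Finset V → Prop :=
    fun C a => ∃ c ∈ C, ∃ u ∈ c, ∃ v ∈ a, IsTight p z u v
  let 𝒞 := 𝒞₀.filter fun C => ¬ ∃ a ∈ Z, adj C a
  have hAZ : A.card + Z.card = A₁.card := Finset.card_filter_add_card_filter_not _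
  have hCs : ∀ C ∈ 𝒞₀, C ⊆ children H D := fun C hC =>
    (h𝒞₀ C hC).1.trans (Finset.filter_subset _ _)
  have hA₁C : ∀ C ∈ 𝒞₀, Disjoint C A₁ := by
    intro C hC
    rw [Finset.disjoint_union_right]
    refine ⟨(h𝒞₀ C hC).2.1, ?_⟩
    rw [Finset.disjoint_left]
    intro c hc hcQ
    exact (Finset.mem_filter.1 hcQ).2 (Finset.mem_filter.1 ((h𝒞₀ C hC).1 hc)).2
  -- A barrier member of weight zero is a single vertex. It is joined to at most one component,
  -- since `isTight_of_zero` would connect two of them by a tight edge.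
  have hrem : (𝒞₀.filter fun C => ∃ a ∈ Z, adj C a).card ≤ Z.card := by
    have hch : ∀ C, ∃ a, C ∈ (𝒞₀.filter fun C => ∃ a ∈ Z, adj C a) → a ∈ Z ∧ adj C a := by
      intro C
      by_cases hC : C ∈ (𝒞₀.filter fun C => ∃ a ∈ Z, adj C a)
      · obtain ⟨a, ha⟩ := (Finset.mem_filter.1 hC).2
        exact ⟨a, fun _ => ha⟩
      · exact ⟨∅, fun h => (hC h).elim⟩
    choose f hf using hch
    refine Finset.card_le_card_of_injOn f (fun C hC => (hf C hC).1) ?_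
    intro C hC C' hC' heq
    by_contra hne
    obtain ⟨haZ, c, hc, u, hu, v, hv, huv⟩ := hf C hC
    obtain ⟨-, c', hc', w, hw, v', hv', hwv⟩ := hf C' hC'
    have hC₀ := (Finset.mem_filter.1 (Finset.mem_coe.1 hC)).1
    have hC₀' := (Finset.mem_filter.1 (Finset.mem_coe.1 hC')).1
    rw [← heq] at hv'
    obtain ⟨ha1, ha0⟩ := Finset.mem_filter.1 haZ
    have hach := hA₁ ha1
    have haH := (mem_children.1 hach).1
    obtain ⟨x, hx⟩ := Finset.card_eq_one.1 ((mem_moatFamily.1 haH).2.resolve_right ha0)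
    rw [hx, Finset.mem_singleton] at hv hv'
    subst hv hv'
    have hzx : z {v'} = 0 :=
      le_antisymm (not_lt.1 (hx ▸ ha0)) (hL.nonneg' (hx ▸ haH))
    have hcc : c ≠ c' := by
      rintro rfl
      exact Finset.disjoint_left.1 (hdis C hC₀ C' hC₀' hne) hc hc'
    have htw := hL.isTight_of_zero hDL (hCs C hC₀ hc) (hCs C' hC₀' hc') hcc hu hw
      (hx ▸ hach) hzx huv hwv.symm
    rcases (h𝒞₀ C hC₀).2.2.2 c hc c' ((h𝒞₀ C' hC₀').1 hc') ⟨u, hu, w, hw, htw⟩ with h | h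
    · exact Finset.disjoint_left.1 (hdis C hC₀ C' hC₀' hne) h hc'
    · exact Finset.disjoint_left.1 (h𝒞₀ C' hC₀').2.1 hc' h
  have h𝒞card : 𝒞.card + (𝒞₀.filter fun C => ∃ a ∈ Z, adj C a).card = 𝒞₀.card := by
    rw [add_comm]
    exact Finset.card_filter_add_card_filter_not _
  have hA₁card : A₁.card ≤ A₀.card + F.card := hQF ▸ Finset.card_union_le _ _
  have h𝒞sub : ∀ C ∈ 𝒞, C ∈ 𝒞₀ := fun C hC => (Finset.mem_filter.1 hC).1
  obtain ⟨b1, b2⟩ := hz.barrier_le (D := D) (A := A) (𝒞 := 𝒞) hV hD1 hD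
    ((Finset.filter_subset _ _).trans hA₁) (fun a ha => (Finset.mem_filter.1 ha).2)
    (fun C hC => hCs C (h𝒞sub C hC))
    (fun C hC => (hA₁C C (h𝒞sub C hC)).mono_right (Finset.filter_subset _ _))
    (fun C hC => (h𝒞₀ C (h𝒞sub C hC)).2.2.1)
    (fun C hC C' hC' => hdis C (h𝒞sub C hC) C' (h𝒞sub C' hC')) (by
      intro C hC c hc b hb hbC hbA u hu v hv huv
      have hbA₁ : b ∈ A₁ := by
        by_cases hbF : Disjoint b F
        · exact Finset.mem_union_left _ (((h𝒞₀ C (h𝒞sub C hC)).2.2.2 c hc b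
            (Finset.mem_filter.2 ⟨hb, hbF⟩) ⟨u, hu, v, hv, huv⟩).resolve_left hbC)
        · exact Finset.mem_union_right _ (Finset.mem_filter.2 ⟨hb, hbF⟩)
      refine (Finset.mem_filter.1 hC).2 ⟨b, Finset.mem_filter.2 ⟨hbA₁, fun h => hbA
        (Finset.mem_filter.2 ⟨hbA₁, h⟩)⟩, c, hc, u, hu, v, hv, huv⟩)
  split_ifs at b1 b2 with hDo
  · have hDodd := mem_oddSets.1 hDo
    have hF1 : F.card = 1 := by
      rw [Nat.odd_iff] at hDodd
      rw [Nat.even_iff] at hpar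
      omega
    -- Here the bound on `|𝒞|` is attained, so the unions would have total size at least `|D|`; but
    -- they are disjoint and avoid the vertex of `F`.
    have b3 := b2 (by omega)
    have hUdis : ∀ C ∈ 𝒞, ∀ C' ∈ 𝒞, C ≠ C' → Disjoint (C.biUnion id) (C'.biUnion id) := by
      intro C hC C' hC' hne
      rw [Finset.disjoint_left]
      intro x hx hx'
      obtain ⟨c, hc, hxc⟩ := Finset.mem_biUnion.1 hx
      obtain ⟨c', hc', hxc'⟩ := Finset.mem_biUnion.1 hx'
      have := hL.child_unique (hCs C (h𝒞sub C hC) hc) (hCs C' (h𝒞sub C' hC') hc') hxc hxc'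
      exact Finset.disjoint_left.1 (hdis C (h𝒞sub C hC) C' (h𝒞sub C' hC') hne) hc (this ▸ hc')
    rw [← Finset.card_biUnion hUdis] at b3
    have hsub : 𝒞.biUnion (fun C => C.biUnion id) ⊆ D \ F := by
      intro x hx
      obtain ⟨C, hC, hx⟩ := Finset.mem_biUnion.1 hx
      obtain ⟨c, hc, hx⟩ := Finset.mem_biUnion.1 hx
      have hcS := Finset.mem_filter.1 ((h𝒞₀ C (h𝒞sub C hC)).1 hc)
      exact Finset.mem_sdiff.2 ⟨(mem_children.1 hcS.1).2.1.1 hx,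
        Finset.disjoint_left.1 hcS.2 hx⟩
    have := Finset.card_le_card hsub
    rw [Finset.card_sdiff_of_subset hFD] at this
    have := Finset.card_le_card hFD
    omega
  · omega

/-- An extremal packing admits, inside each member `D` of its family, a matching by tight edges
that misses only a prescribed vertex, and whose weight is given by the packing. -/
theorem IsExtremalPacking.exists_near_matching [Nonempty V] {p : V → X} {z : Finset V → ℝ}
    (hz : IsExtremalPacking p z) (hV : Even (Fintype.card V)) (k : ℕ) :
    ∀ D : Finset V, D.card ≤ k → (D = Finset.univ ∨ D ∈ moatFamily z) → ∀ F ⊆ D, F.card ≤ 1 →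
    Even (D.card + F.card) → ∃ σ : V → V,
      (∀ u ∈ D, σ u ∈ D ∧ σ (σ u) = u ∧ (σ u = u ↔ u ∈ F)) ∧
      ∑ u ∈ D, dist (p u) (p (σ u)) =
        2 * ∑ E ∈ moatFamily z with E ⊂ D ∧ Disjoint E F, z E := by
  classical
  have hL := hz.isLaminarPacking
  have hpos : ∀ E ∈ moatFamily z, E.Nonempty := fun E hE =>
    Finset.card_pos.1 (mem_oddSets.1 (hL.odd hE)).pos
  induction k with
  | zero =>
    intro D hk hD F hFD hF hpar
    obtain rfl : D = ∅ := Finset.card_eq_zero.1 (Nat.le_zero.1 hk)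
    refine ⟨id, by simp, ?_⟩
    rw [Finset.filter_false_of_mem]
    · simp
    · intro E hE h
      exact Finset.not_ssubset_empty _ h.1
  | succ k ih =>
    intro D hk hD F hFD hF hpar
    by_cases hD1 : D.card = 1
    · obtain ⟨v, rfl⟩ := Finset.card_eq_one.1 hD1
      have hFv : F = {v} := by
        refine Finset.eq_of_subset_of_card_le hFD ?_
        rw [Finset.card_singleton] at hpar ⊢
        rw [Nat.even_iff] at hpar
        omega
      refine ⟨id, by simp [hFv], ?_⟩
      rw [Finset.filter_false_of_mem]
      · simp
      · intro E hE h
        have := Finset.ssubset_singleton_iff.1 h.1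
        exact (hpos E hE).ne_empty this
    obtain ⟨m, hm⟩ := hz.exists_child_matching hV hD1 hD hFD hF hpar
    have hDL := hz.mem_or_univ_laminar hD
    set H := moatFamily z with hH
    set S : Finset (Finset V) := {c ∈ children H D | Disjoint c F} with hS
    have hSc : ∀ c ∈ S, c ∈ children H D := fun c hc => (Finset.mem_filter.1 hc).1
    obtain ⟨x, hx⟩ := exists_involution_choice S m (fun c hc => ⟨(hm c hc).1, (hm c hc).2.1,
      (hm c hc).2.2.1⟩) (fun c b u v => u ∈ c ∧ v ∈ b ∧ IsTight p z u v)
      (fun c b u v h => ⟨h.2.1, h.1, h.2.2.symm⟩) (fun c hc => by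
        obtain ⟨u, hu, v, hv, h⟩ := (hm c hc).2.2.2
        exact ⟨u, v, hu, hv, h⟩)
    -- the vertex of each child that is matched outside the child
    have hy : ∀ c, ∃ y, (c ∈ S → y = x c) ∧ (c ∈ children H D → c ∉ S → y ∈ c ∧ y ∈ F) := by
      intro c
      by_cases hc : c ∈ S
      · exact ⟨x c, fun _ => rfl, fun _ h => (h hc).elim⟩
      · by_cases hc' : c ∈ children H D
        · have : ¬ Disjoint c F := fun h => hc (Finset.mem_filter.2 ⟨hc', h⟩)
          obtain ⟨y, hy1, hy2⟩ := Finset.not_disjoint_iff.1 this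
          exact ⟨y, fun h => (hc h).elim, fun _ _ => ⟨hy1, hy2⟩⟩
        · exact ⟨Classical.arbitrary V, fun h => (hc h).elim, fun h => (hc' h).elim⟩
    choose y hyS hyF using hy
    have hyc : ∀ c ∈ children H D, y c ∈ c := by
      intro c hc
      by_cases hcS : c ∈ S
      · rw [hyS c hcS]
        exact (hx c hcS).1
      · exact (hyF c hc hcS).1
    have hytight : ∀ c ∈ S, IsTight p z (y c) (y (m c)) := by
      intro c hc
      rw [hyS c hc, hyS _ (hm c hc).1]
      exact (hx c hc).2.2
    have hFy : ∀ c ∈ children H D, c ∉ S → F = {y c} := by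
      intro c hc hcS
      refine (Finset.eq_of_subset_of_card_le (Finset.singleton_subset_iff.2
        (hyF c hc hcS).2) ?_).symm
      simpa using hF
    have hIH : ∀ c, ∃ σ : V → V, c ∈ children H D →
        (∀ u ∈ c, σ u ∈ c ∧ σ (σ u) = u ∧ (σ u = u ↔ u = y c)) ∧
        ∑ u ∈ c, dist (p u) (p (σ u)) = 2 * ∑ E ∈ H with E ⊂ c ∧ y c ∉ E, z E := by
      intro c
      by_cases hc : c ∈ children H D
      · have hc' := mem_children.1 hc
        obtain ⟨σ, h1, h2⟩ := ih c (by
          have := Finset.card_lt_card hc'.2.1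
          omega) (Or.inr hc'.1) {y c} (Finset.singleton_subset_iff.2 (hyc c hc)) (by simp) (by
          rw [Finset.card_singleton]
          exact (mem_oddSets.1 (hL.odd hc'.1)).add_one)
        refine ⟨σ, fun _ => ⟨by simpa using h1, ?_⟩⟩
        simpa using h2
      · exact ⟨id, fun h => (hc h).elim⟩
    choose τ hτ using hIH
    have hk : ∀ u, ∃ c, u ∈ D → c ∈ children H D ∧ u ∈ c := by
      intro u
      by_cases hu : u ∈ D
      · obtain ⟨c, hc⟩ := hL.exists_child_mem hD1 hu
        exact ⟨c, fun _ => hc⟩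
      · exact ⟨∅, fun h => (hu h).elim⟩
    choose κ hκ using hk
    have hκc : ∀ c ∈ children H D, ∀ u ∈ c, κ u = c := by
      intro c hc u hu
      have huD := (mem_children.1 hc).2.1.1 hu
      exact hL.child_unique (hκ u huD).1 hc (hκ u huD).2 hu
    -- The distinguished vertices `y c` are paired across children by `m`, the one in `F` stays
    -- fixed, and all other vertices follow the inductive matchings.
    let σ : V → V := fun u =>
      if u = y (κ u) then (if κ u ∈ S then y (m (κ u)) else u) else τ (κ u) u
    have hσ1 : ∀ c ∈ S, σ (y c) = y (m c) := by
      intro c hc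
      simp only [σ]
      rw [hκc c (hSc c hc) _ (hyc c (hSc c hc)), if_pos rfl, if_pos hc]
    have hσ2 : ∀ c ∈ children H D, c ∉ S → σ (y c) = y c := by
      intro c hc hcS
      simp only [σ]
      rw [hκc c hc _ (hyc c hc), if_pos rfl, if_neg hcS]
    have hσ3 : ∀ c ∈ children H D, ∀ u ∈ c, u ≠ y c → σ u = τ c u := by
      intro c hc u hu hne
      simp only [σ]
      rw [hκc c hc u hu, if_neg hne]
    refine ⟨σ, ?_, ?_⟩
    · intro u hu
      obtain ⟨hc, huc⟩ := hκ u hu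
      have hcD := (mem_children.1 hc).2.1.1
      set c := κ u
      by_cases huy : u = y c
      · by_cases hcS : c ∈ S
        · have hm' := hm c hcS
          have hmc := hyc (m c) (hSc _ hm'.1)
          have huF : u ∉ F := Finset.disjoint_left.1 (Finset.mem_filter.1 hcS).2 huc
          rw [huy, hσ1 c hcS, hσ1 _ hm'.1, hm'.2.1, ← huy]
          refine ⟨(mem_children.1 (hSc _ hm'.1)).2.1.1 hmc, rfl, ?_⟩
          refine iff_of_false (fun h => hm'.2.2.1 ?_) huF
          rw [h] at hmc
          exact hL.child_unique (hSc _ hm'.1) hc hmc huc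
        · rw [huy, hσ2 c hc hcS, hσ2 c hc hcS, ← huy]
          exact ⟨hu, rfl, iff_of_true rfl (huy ▸ (hyF c hc hcS).2)⟩
      · obtain ⟨h1, h2, h3⟩ := (hτ c hc).1 u huc
        have hne : τ c u ≠ y c := by
          intro h
          have h4 := ((hτ c hc).1 (y c) (hyc c hc)).2.2.2 rfl
          rw [h, h4] at h2
          exact huy h2.symm
        rw [hσ3 c hc u huc huy, hσ3 c hc _ h1 hne, h2]
        refine ⟨hcD h1, rfl, iff_of_false (fun h => huy (h3.1 h)) fun huF => ?_⟩
        by_cases hcS : c ∈ S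
        · exact Finset.disjoint_left.1 (Finset.mem_filter.1 hcS).2 huc huF
        · rw [hFy c hc hcS, Finset.mem_singleton] at huF
          exact huy huF
    · have hdisj : ∀ a ∈ children H D, ∀ b ∈ children H D, a ≠ b → Disjoint a b :=
        fun a ha b hb hab => hL.children_disjoint ha hb hab
      let g : Finset V → ℝ := fun c => ∑ E ∈ H with y c ∈ E ∧ E ⊆ c, z E
      let e : Finset V → ℝ := fun c => ∑ E ∈ H with E ⊂ c ∧ y c ∉ E, z E
      -- Only `y c` is rematched. Its tight edge has length `g c + g (m c)`: the sets it crosses are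
      -- those inside `c` around `y c` and those inside `m c` around `y (m c)`.
      have hinner : ∀ c ∈ children H D, ∑ u ∈ c, dist (p u) (p (σ u)) =
          (if c ∈ S then g c + g (m c) else 0) + 2 * e c := by
        intro c hc
        have h1 : ∑ u ∈ c, (dist (p u) (p (σ u)) - dist (p u) (p (τ c u))) =
            dist (p (y c)) (p (σ (y c))) := by
          rw [Finset.sum_eq_single_of_mem (y c) (hyc c hc)]
          · rw [((hτ c hc).1 (y c) (hyc c hc)).2.2.2 rfl, dist_self, sub_zero]
          · intro u hu hne
            rw [hσ3 c hc u hu hne, sub_self]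
        rw [Finset.sum_sub_distrib, (hτ c hc).2, sub_eq_iff_eq_add] at h1
        rw [h1]
        congr 1
        split_ifs with hcS
        · have hm' := hm c hcS
          have hmc := hSc _ hm'.1
          rw [hσ1 c hcS, ← hytight c hcS, hL.cut_eq]
          simp only [g]
          rw [← Finset.sum_union]
          · congr 1
            ext E
            simp only [Finset.mem_union, Finset.mem_filter, ← and_or_left]
            refine and_congr_right fun hE => ?_
            exact hL.separates_iff hDL hc hmc hm'.2.2.1.symm (hyc c hc) (hyc _ hmc) hE
          · rw [Finset.disjoint_left]
            intro E hE hE'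
            have hE := (Finset.mem_filter.1 hE).2
            have hE' := (Finset.mem_filter.1 hE').2
            exact hm'.2.2.1 (hL.child_unique hmc hc (hE'.2 hE.1) (hyc c hc) |>.symm ▸ rfl)
        · rw [hσ2 c hc hcS, dist_self]
      have hleft : ∑ u ∈ D, dist (p u) (p (σ u)) =
          ∑ c ∈ children H D, ((if c ∈ S then g c + g (m c) else 0) + 2 * e c) := by
        conv_lhs => rw [← hL.biUnion_children hD1]
        rw [Finset.sum_biUnion (t := id) fun a ha b hb hab => hdisj a ha b hb hab]
        exact Finset.sum_congr rfl hinner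
      -- The members inside a child split into those that contain `y c`, counted by `g`, and those
      -- that do not, counted by `e`; in the child meeting `F` only the latter avoid `F`.
      have hright : ∑ E ∈ H with E ⊂ D ∧ Disjoint E F, z E =
          ∑ c ∈ children H D, ((if c ∈ S then g c else 0) + e c) := by
        have h1 : ({E ∈ H | E ⊂ D ∧ Disjoint E F} : Finset (Finset V)) =
            (children H D).biUnion fun c => {E ∈ H | E ⊆ c ∧ Disjoint E F} := by
          ext E
          simp only [Finset.mem_filter, Finset.mem_biUnion]
          constructor
          · rintro ⟨hE, hED, hEF⟩
            obtain ⟨c, hc, hEc⟩ := exists_child hE hED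
            exact ⟨c, hc, hE, hEc, hEF⟩
          · rintro ⟨c, hc, hE, hEc, hEF⟩
            exact ⟨hE, hEc.trans_ssubset (mem_children.1 hc).2.1, hEF⟩
        rw [h1, Finset.sum_biUnion]
        · refine Finset.sum_congr rfl fun c hc => ?_
          split_ifs with hcS
          · simp only [g, e]
            rw [← Finset.sum_union]
            · congr 1
              ext E
              simp only [Finset.mem_union, Finset.mem_filter, ← and_or_left]
              refine and_congr_right fun hE => ?_
              constructor
              · rintro ⟨h, -⟩
                by_cases hyE : y c ∈ E
                · exact Or.inl ⟨hyE, h⟩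
                · exact Or.inr ⟨h.ssubset_of_ne fun h => hyE (h ▸ hyc c hc), hyE⟩
              · intro h
                have hEc : E ⊆ c := h.elim And.right fun h => h.1.1
                exact ⟨hEc, (Finset.mem_filter.1 hcS).2.mono_left hEc⟩
            · rw [Finset.disjoint_left]
              intro E hE hE'
              exact (Finset.mem_filter.1 hE').2.2 (Finset.mem_filter.1 hE).2.1
          · rw [zero_add]
            simp only [e]
            congr 1
            ext E
            simp only [Finset.mem_filter]
            refine and_congr_right fun hE => ?_
            rw [hFy c hc hcS, Finset.disjoint_singleton_right]
            refine and_congr_left fun hyE => ?_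
            exact ⟨fun h => h.ssubset_of_ne fun h => hyE (h ▸ hyc c hc), fun h => h.1⟩
        · intro c hc c' hc' hne
          rw [Function.onFun, Finset.disjoint_left]
          intro E hE hE'
          obtain ⟨hEH, hEc, -⟩ := Finset.mem_filter.1 hE
          obtain ⟨-, hEc', -⟩ := Finset.mem_filter.1 hE'
          obtain ⟨w, hw⟩ := hpos E hEH
          exact hne (hL.child_unique hc hc' (hEc hw) (hEc' hw))
      have hswap : ∑ c ∈ S, g (m c) = ∑ c ∈ S, g c :=
        Finset.sum_nbij' m m (fun c hc => (hm c hc).1) (fun c hc => (hm c hc).1)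
          (fun c hc => (hm c hc).2.1) (fun c hc => (hm c hc).2.1) (fun c hc => rfl)
      have hfilt : ∀ f : Finset V → ℝ, ∑ c ∈ children H D, (if c ∈ S then f c else 0) =
          ∑ c ∈ S, f c := by
        intro f
        rw [← Finset.sum_filter]
        congr 1
        ext c
        rw [Finset.mem_filter]
        exact ⟨fun h => h.2, fun h => ⟨hSc c h, h⟩⟩
      rw [hleft, hright, Finset.sum_add_distrib, Finset.sum_add_distrib, hfilt, hfilt,
        Finset.sum_add_distrib, hswap, ← Finset.mul_sum]
      ring

end
-- Moat functions and their joint Lipschitz bound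
section
variable {X V : Type*} [MetricSpace X] [Fintype V] [DecidableEq V]

/-- The total weight of the members of `H` that lie properly between the vertex `v` and `D`. -/
noncomputable def innerWeight (z : Finset V → ℝ) (H : Finset (Finset V)) (D : Finset V)
    (v : V) : ℝ := ∑ E ∈ H with v ∈ E ∧ E ⊂ D, z E

theorem moat_le {V : Type*} [DecidableEq V] (p : V → X) (z : Finset V → ℝ) (H : Finset (Finset V))
    (D : Finset V) (a : X) : moat p z H D a ≤ z D := min_le_right _ _

/-- Below the cap `z D` the value is the minimum over `D`, attained at some vertex. With
`le_dist_of_moat_pos` this turns moat values into upper and lower distance bounds. -/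
theorem exists_dist_le_of_moat_lt {p : V → X} {z : Finset V → ℝ} {H : Finset (Finset V)}
    {D : Finset V} (hD : D.Nonempty) {a : X} (h : moat p z H D a < z D) :
    ∃ v ∈ D, dist a (p v) ≤ innerWeight z H D v + moat p z H D a := by
  have : Nonempty {v // v ∈ D} := hD.to_subtype
  obtain ⟨v, hv⟩ := exists_eq_ciInf_of_finite
    (f := fun v : {v // v ∈ D} => max (dist a (p v) - ∑ E ∈ H with v.1 ∈ E ∧ E ⊂ D, z E) 0)
  refine ⟨v, v.2, ?_⟩
  have hm : moat p z H D a = max (dist a (p v) - innerWeight z H D v) 0 := by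
    unfold moat at h ⊢
    rw [min_eq_left ((min_lt_iff.1 h).resolve_right (lt_irrefl _)).le, ← hv, innerWeight]
  have := le_max_left (dist a (p v) - innerWeight z H D v) 0
  rw [← hm] at this
  linarith

theorem moat_le_max (p : V → X) (z : Finset V → ℝ) (H : Finset (Finset V)) {D : Finset V}
    (a : X) {v : V} (hv : v ∈ D) :
    moat p z H D a ≤ max (dist a (p v) - innerWeight z H D v) 0 :=
  (min_le_left _ _).trans (ciInf_le (Set.finite_range _).bddBelow (⟨v, hv⟩ : {v // v ∈ D}))

theorem le_dist_of_moat_pos {p : V → X} {z : Finset V → ℝ} {H : Finset (Finset V)}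
    {D : Finset V} {a : X} (h : 0 < moat p z H D a) {v : V} (hv : v ∈ D) :
    innerWeight z H D v + moat p z H D a ≤ dist a (p v) := by
  have h1 := moat_le_max p z H a hv
  rcases le_max_iff.1 h1 with h2 | h2
  · linarith
  · linarith

namespace IsLaminarPacking

variable {p : V → X} {z : Finset V → ℝ} {H : Finset (Finset V)}

theorem nonempty_of_mem (h : IsLaminarPacking p z H) {D : Finset V} (hD : D ∈ H) : D.Nonempty :=
  Finset.card_pos.1 (mem_oddSets.1 (h.odd hD)).pos

theorem moat_nonneg (h : IsLaminarPacking p z H) {D : Finset V} (hD : D ∈ H) (a : X) :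
    0 ≤ moat p z H D a :=
  le_min (Real.iInf_nonneg fun _ => le_max_right _ _) (h.nonneg' hD)

theorem moat_eq_weight (h : IsLaminarPacking p z H) {D : Finset V} (hD : D ∈ H) {a : X}
    (ha : ∀ v ∈ D, innerWeight z H D v + z D ≤ dist a (p v)) : moat p z H D a = z D := by
  have : Nonempty {v // v ∈ D} := (h.nonempty_of_mem hD).to_subtype
  refine min_eq_right (le_ciInf fun v => le_max_of_le_left ?_)
  have := ha v v.2
  unfold innerWeight at this
  linarith

theorem moat_eq_zero (h : IsLaminarPacking p z H) {D : Finset V} (hD : D ∈ H) {a : X} {v : V}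
    (hv : v ∈ D) (ha : dist a (p v) ≤ innerWeight z H D v) : moat p z H D a = 0 := by
  refine le_antisymm ((moat_le_max p z H a hv).trans (max_le ?_ le_rfl)) (h.moat_nonneg hD a)
  linarith

theorem innerWeight_nonneg (h : IsLaminarPacking p z H) (D : Finset V) (v : V) :
    0 ≤ innerWeight z H D v :=
  Finset.sum_nonneg fun _ hE => h.nonneg' (Finset.mem_filter.1 hE).1

/-- Weights of distinct sets add up along a chain. -/
theorem innerWeight_add_sum_le (h : IsLaminarPacking p z H) {D T : Finset V} {v : V} (hv : v ∈ D)
    (hDT : D ⊆ T) {U : Finset (Finset V)} (hU : U ⊆ H) (hDU : ∀ E ∈ U, D ⊆ E)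
    (hUT : ∀ E ∈ U, E ⊂ T) : innerWeight z H D v + ∑ E ∈ U, z E ≤ innerWeight z H T v := by
  unfold innerWeight
  rw [← Finset.sum_union]
  · refine Finset.sum_le_sum_of_subset_of_nonneg ?_ fun E hE _ => h.nonneg' (Finset.mem_filter.1 hE).1
    intro E hE
    rcases Finset.mem_union.1 hE with hE | hE
    · obtain ⟨h1, h2, h3⟩ := Finset.mem_filter.1 hE
      exact Finset.mem_filter.2 ⟨h1, h2, h3.trans_subset hDT⟩
    · exact Finset.mem_filter.2 ⟨hU hE, hDU E hE hv, hUT E hE⟩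
  · rw [Finset.disjoint_left]
    intro E hE hEU
    exact (Finset.mem_filter.1 hE).2.2.2 (hDU E hEU)

/-- Weights of distinct sets add up along two chains that separate two vertices. -/
theorem innerWeight_add_sum_le_dist (h : IsLaminarPacking p z H) {D T : Finset V}
    {v w : V} (hv : v ∈ D) (hw : w ∈ T) {U W : Finset (Finset V)} (hU : U ⊆ H) (hW : W ⊆ H)
    (hDU : ∀ E ∈ U, D ⊆ E) (hTW : ∀ E ∈ W, T ⊆ E) (hUw : ∀ E ∈ U, w ∉ E)
    (hWv : ∀ E ∈ W, v ∉ E) (hDT : Disjoint D T) :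
    (innerWeight z H D v + ∑ E ∈ U, z E) + (innerWeight z H T w + ∑ E ∈ W, z E) ≤
      dist (p v) (p w) := by
  have hvT : v ∉ T := Finset.disjoint_left.1 hDT hv
  have hwD : w ∉ D := Finset.disjoint_right.1 hDT hw
  refine le_trans ?_ (h.cut_le v w)
  rw [h.cut_eq]
  unfold innerWeight
  rw [← Finset.sum_union, ← Finset.sum_union, ← Finset.sum_union]
  · refine Finset.sum_le_sum_of_subset_of_nonneg ?_ fun E hE _ => h.nonneg' (Finset.mem_filter.1 hE).1
    intro E hE
    rw [Finset.mem_filter]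
    have sep1 : v ∈ E → w ∉ E → Separates E v w := fun h1 h2 h3 => h2 (h3.1 h1)
    have sep2 : w ∈ E → v ∉ E → Separates E v w := fun h1 h2 h3 => h2 (h3.2 h1)
    rcases Finset.mem_union.1 hE with hE | hE <;> rcases Finset.mem_union.1 hE with hE | hE
    · obtain ⟨h1, h2, h3⟩ := Finset.mem_filter.1 hE
      exact ⟨h1, sep1 h2 fun h => hwD (h3.1 h)⟩
    · exact ⟨hU hE, sep1 (hDU E hE hv) (hUw E hE)⟩
    · obtain ⟨h1, h2, h3⟩ := Finset.mem_filter.1 hE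
      exact ⟨h1, sep2 h2 fun h => hvT (h3.1 h)⟩
    · exact ⟨hW hE, sep2 (hTW E hE hw) (hWv E hE)⟩
  · rw [Finset.disjoint_left]
    intro E hE hE'
    have hvE : v ∈ E := (Finset.mem_union.1 hE).elim (fun h => (Finset.mem_filter.1 h).2.1)
      fun h => hDU E h hv
    rcases Finset.mem_union.1 hE' with hE' | hE'
    · exact hvT ((Finset.mem_filter.1 hE').2.2.1 hvE)
    · exact hWv E hE' hvE
  · rw [Finset.disjoint_left]
    intro E hE hEU
    exact (Finset.mem_filter.1 hE).2.2.2 (hTW E hEU)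
  · rw [Finset.disjoint_left]
    intro E hE hEU
    exact (Finset.mem_filter.1 hE).2.2.2 (hDU E hEU)

theorem innerWeight_add_le_dist (h : IsLaminarPacking p z H) {D T : Finset V} (hD : D ∈ H)
    (hT : T ∈ H) (hDT : Disjoint D T) {v w : V} (hv : v ∈ D) (hw : w ∈ T) :
    (innerWeight z H D v + z D) + (innerWeight z H T w + z T) ≤ dist (p v) (p w) := by
  simpa using h.innerWeight_add_sum_le_dist hv hw (U := {D}) (W := {T}) (by simpa) (by simpa)
    (by simp) (by simp) (by simpa using Finset.disjoint_right.1 hDT hw)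
    (by simpa using Finset.disjoint_left.1 hDT hv) hDT

/-- The outer moat vanishes where the inner one is not full. -/
theorem moat_eq_zero_of_ssubset (h : IsLaminarPacking p z H) {E D : Finset V} (hE : E ∈ H)
    (hD : D ∈ H) (hED : E ⊂ D) {a : X} (ha : moat p z H E a < z E) : moat p z H D a = 0 := by
  obtain ⟨v, hv, hav⟩ := exists_dist_le_of_moat_lt (h.nonempty_of_mem hE) ha
  refine h.moat_eq_zero hD (hED.1 hv) ?_
  -- The width of `E` itself is part of the inner weight of `D` at `v`.
  have := h.innerWeight_add_sum_le hv hED.1 (U := {E}) (by simpa) (by simp) (by simpa)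
  rw [Finset.sum_singleton] at this
  linarith

/-- Moats of disjoint sets do not overlap. -/
theorem moat_eq_weight_of_disjoint (h : IsLaminarPacking p z H) {D T : Finset V} (hD : D ∈ H)
    (hT : T ∈ H) (hDT : Disjoint D T) {a : X} (ha : moat p z H D a < z D) :
    moat p z H T a = z T := by
  obtain ⟨v, hv, hav⟩ := exists_dist_le_of_moat_lt (h.nonempty_of_mem hD) ha
  refine h.moat_eq_weight hT fun w hw => ?_
  -- A point still within the moat of `D` near `v` is, by the packing constraint on `v` and `w`,
  -- beyond the moat of `T` around `w`.
  have h1 := h.innerWeight_add_le_dist hD hT hDT hv hw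
  have h2 := dist_triangle_left (p v) (p w) a
  linarith

/-- The members of `H` whose moat functions increase from `a` to `b` form a chain. -/
theorem rising_chain (h : IsLaminarPacking p z H) {a b : X} {D T : Finset V} (hD : D ∈ H)
    (hT : T ∈ H) (hDab : moat p z H D a < moat p z H D b)
    (hTab : moat p z H T a < moat p z H T b) : D ⊆ T ∨ T ⊆ D := by
  rcases h.laminar D hD T hT with h1 | h1 | h1
  · exact Or.inl h1
  · exact Or.inr h1
  · have := h.moat_eq_weight_of_disjoint hD hT h1 (hDab.trans_le (moat_le p z H D b))
    exact ((hTab.trans_le (moat_le p z H T b)).ne this).elim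

/-- Rising members form a chain, so a minimal one is least. It is not full at `a`, which places `a`
near one of its vertices. -/
theorem exists_least_rising (h : IsLaminarPacking p z H) {a b : X}
    (hne : {D ∈ H | moat p z H D a < moat p z H D b}.Nonempty) :
    ∃ D ∈ {D ∈ H | moat p z H D a < moat p z H D b},
      (∀ T ∈ {D ∈ H | moat p z H D a < moat p z H D b}, D ⊆ T) ∧
      ∃ v ∈ D, dist a (p v) ≤ innerWeight z H D v + moat p z H D a := by
  obtain ⟨D, hD⟩ := Finset.exists_minimal hne
  obtain ⟨hDH, hDab⟩ := Finset.mem_filter.1 hD.prop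
  refine ⟨D, hD.prop, fun T hT => ?_, exists_dist_le_of_moat_lt (h.nonempty_of_mem hDH)
    (hDab.trans_le (moat_le p z H D b))⟩
  obtain ⟨hTH, hTab⟩ := Finset.mem_filter.1 hT
  rcases h.rising_chain hDH hTH hDab hTab with h1 | h1
  · exact h1
  · exact hD.le_of_le hT h1

/-- Measure from the vertex `v` of the least rising set that is near `a`: positivity of the greatest
moat at `b` puts `b` beyond all the smaller rising moats around `v`, and the triangle inequality
compares the two distances. -/
theorem sum_rising_le (h : IsLaminarPacking p z H) (a b : X) :
    ∑ D ∈ H with moat p z H D a < moat p z H D b, (moat p z H D b - moat p z H D a) ≤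
      dist a b := by
  rcases Finset.eq_empty_or_nonempty {D ∈ H | moat p z H D a < moat p z H D b} with he | hne
  · rw [he, Finset.sum_empty]
    exact dist_nonneg
  obtain ⟨D, hDU, hleast, v, hv, hav⟩ := h.exists_least_rising hne
  obtain ⟨T, hT⟩ := Finset.exists_maximal hne
  have hTU := hT.prop
  set U := {D ∈ H | moat p z H D a < moat p z H D b} with hU
  have hgreat : ∀ E ∈ U, E ⊆ T := by
    intro E hE
    obtain ⟨hEH, hEab⟩ := Finset.mem_filter.1 hE
    obtain ⟨hTH, hTab⟩ := Finset.mem_filter.1 hTU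
    rcases h.rising_chain hEH hTH hEab hTab with h1 | h1
    · exact h1
    · exact hT.le_of_ge hE h1
  have hTH := (Finset.mem_filter.1 hTU).1
  have h1 : innerWeight z H D v + ∑ E ∈ U.erase T, z E ≤ innerWeight z H T v :=
    h.innerWeight_add_sum_le hv (hleast T hTU)
      ((Finset.erase_subset _ _).trans (Finset.filter_subset _ _))
      (fun E hE => hleast E (Finset.mem_of_mem_erase hE))
      (fun E hE => (hgreat E (Finset.mem_of_mem_erase hE)).ssubset_of_ne
        (Finset.ne_of_mem_erase hE))
  have h2 := le_dist_of_moat_pos ((h.moat_nonneg hTH a).trans_lt (Finset.mem_filter.1 hTU).2)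
    (hleast T hTU hv)
  have h3 : ∑ E ∈ U, moat p z H E b ≤ ∑ E ∈ U.erase T, z E + moat p z H T b := by
    rw [← Finset.sum_erase_add U _ hTU]
    exact add_le_add_left (Finset.sum_le_sum fun E _ => moat_le p z H E b) _
  have h4 : moat p z H D a ≤ ∑ E ∈ U, moat p z H E a :=
    Finset.single_le_sum (f := fun E => moat p z H E a)
      (fun E hE => h.moat_nonneg (Finset.mem_filter.1 hE).1 a) hDU
  have h5 := dist_triangle b a (p v)
  rw [dist_comm b a] at h5
  rw [Finset.sum_sub_distrib]
  linarith

/-- The moat functions together form a `1`-Lipschitz map into `ℓ¹`. -/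
theorem sum_abs_moat_sub_le (h : IsLaminarPacking p z H) (a b : X) :
    ∑ D ∈ H, |moat p z H D a - moat p z H D b| ≤ dist a b := by
  have hsplit : ∑ D ∈ H, |moat p z H D a - moat p z H D b| =
      ∑ D ∈ H with moat p z H D a < moat p z H D b, (moat p z H D b - moat p z H D a) +
      ∑ D ∈ H with moat p z H D b < moat p z H D a, (moat p z H D a - moat p z H D b) := by
    rw [Finset.sum_filter, Finset.sum_filter, ← Finset.sum_add_distrib]
    refine Finset.sum_congr rfl fun D _ => ?_
    rcases lt_trichotomy (moat p z H D a) (moat p z H D b) with h1 | h1 | h1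
    · rw [if_pos h1, if_neg h1.not_gt, add_zero, abs_sub_comm, abs_of_pos (sub_pos.2 h1)]
    · simp [h1]
    · rw [if_pos h1, if_neg h1.not_gt, zero_add, abs_of_pos (sub_pos.2 h1)]
  rw [hsplit]
  rcases Finset.eq_empty_or_nonempty {D ∈ H | moat p z H D a < moat p z H D b} with he | hne
  · rw [he, Finset.sum_empty, zero_add, dist_comm]
    exact h.sum_rising_le b a
  rcases Finset.eq_empty_or_nonempty {D ∈ H | moat p z H D b < moat p z H D a} with he' | hne'
  · rw [he', Finset.sum_empty, add_zero]
    exact h.sum_rising_le a b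
  obtain ⟨D, hDU, hDleast, v, hv, hav⟩ := h.exists_least_rising hne
  obtain ⟨T, hTW, hTleast, w, hw, hbw⟩ := h.exists_least_rising hne'
  set U := {D ∈ H | moat p z H D a < moat p z H D b} with hU
  set W := {D ∈ H | moat p z H D b < moat p z H D a} with hW
  -- If the sets were nested, the inner one would not be full at the end where its value is smaller,
  -- so the outer moat would vanish there; but the outer value has to fall on leaving that end.
  have hdis : ∀ E ∈ U, ∀ E' ∈ W, Disjoint E E' := by
    intro E hE E' hE'
    obtain ⟨hEH, hEab⟩ := Finset.mem_filter.1 hE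
    obtain ⟨hEH', hEab'⟩ := Finset.mem_filter.1 hE'
    have hne : E ≠ E' := by
      rintro rfl
      exact lt_asymm hEab hEab'
    rcases h.laminar E hEH E' hEH' with h1 | h1 | h1
    · have := h.moat_eq_zero_of_ssubset hEH hEH' (h1.ssubset_of_ne hne)
        (hEab.trans_le (moat_le p z H E b))
      linarith [h.moat_nonneg hEH' b]
    · have := h.moat_eq_zero_of_ssubset hEH' hEH (h1.ssubset_of_ne hne.symm)
        (hEab'.trans_le (moat_le p z H E' a))
      linarith [h.moat_nonneg hEH a]
    · exact h1
  -- The two chains surround `v` near `a` and `w` near `b`. All their widths fit between `v` and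
  -- `w`, and the path through `a` and `b` bounds that distance.
  have h1 := h.innerWeight_add_sum_le_dist hv hw (Finset.filter_subset _ H)
    (Finset.filter_subset _ H) hDleast hTleast
    (fun E hE => Finset.disjoint_right.1 (hdis E hE T hTW) hw)
    (fun E hE => Finset.disjoint_left.1 (hdis D hDU E hE) hv) (hdis D hDU T hTW)
  have h2 : ∑ E ∈ U, moat p z H E b ≤ ∑ E ∈ U, z E :=
    Finset.sum_le_sum fun E _ => moat_le p z H E b
  have h3 : ∑ E ∈ W, moat p z H E a ≤ ∑ E ∈ W, z E :=
    Finset.sum_le_sum fun E _ => moat_le p z H E a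
  have h4 : moat p z H D a ≤ ∑ E ∈ U, moat p z H E a :=
    Finset.single_le_sum (f := fun E => moat p z H E a)
      (fun E hE => h.moat_nonneg (Finset.mem_filter.1 hE).1 a) hDU
  have h5 : moat p z H T b ≤ ∑ E ∈ W, moat p z H E b :=
    Finset.single_le_sum (f := fun E => moat p z H E b)
      (fun E hE => h.moat_nonneg (Finset.mem_filter.1 hE).1 b) hTW
  have h6 := dist_triangle4 (p v) a b (p w)
  rw [dist_comm (p v) a] at h6
  rw [Finset.sum_sub_distrib, Finset.sum_sub_distrib]
  linarith

/-- A vertex outside `D` forms a member of `H` disjoint from `D`, even when its weight is zero, so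
the packing constraint puts it beyond the moat. -/
theorem moat_vertex (h : IsLaminarPacking p z H) {D : Finset V} (hD : D ∈ H) (v : V) :
    moat p z H D (p v) = if v ∈ D then 0 else z D := by
  split_ifs with hv
  · refine h.moat_eq_zero hD hv ?_
    rw [dist_self]
    exact h.innerWeight_nonneg D v
  · refine h.moat_eq_weight hD fun w hw => ?_
    have := h.innerWeight_add_le_dist hD (h.singleton_mem v)
      (Finset.disjoint_singleton_right.2 hv) hw (Finset.mem_singleton_self v)
    rw [dist_comm]
    linarith [h.innerWeight_nonneg {v} v, h.nonneg' (h.singleton_mem v)]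

end IsLaminarPacking
end

/-! ### Weak duality and complementary slackness -/

section
variable {X V : Type*} [MetricSpace X]

/-- A fixed-point free involution is a perfect matching of the complete graph. -/
theorem exists_isPerfectMatching_of_involution [Fintype V] [DecidableEq V] (p : V → X)
    (σ : V → V) (hσ : ∀ u, σ (σ u) = u) (hne : ∀ u, σ u ≠ u) :
    ∃ M : (⊤ : SimpleGraph V).Subgraph, M.IsPerfectMatching ∧
      2 * weight p M = ∑ u, dist (p u) (p (σ u)) := by
  let M : (⊤ : SimpleGraph V).Subgraph :=
    { verts := Set.univ
      Adj := fun u v => σ u = v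
      adj_sub := by
        rintro u v rfl
        exact (hne u).symm
      edge_vert := fun _ => Set.mem_univ _
      symm := ⟨by
        rintro u v rfl
        exact hσ u⟩ }
  refine ⟨M, ?_, ?_⟩
  · rw [SimpleGraph.Subgraph.isPerfectMatching_iff]
    exact fun v => ⟨σ v, rfl, fun w hw => Eq.symm hw⟩
  · have hedge : M.edgeSet = ((Finset.univ.image fun u => s(u, σ u) : Finset (Sym2 V)) :
        Set (Sym2 V)) := by
      ext e
      induction e using Sym2.ind with
      | h a b =>
        rw [SimpleGraph.Subgraph.mem_edgeSet]
        simp only [Finset.coe_image, Finset.coe_univ, Set.image_univ, Set.mem_range, Sym2.eq_iff]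
        constructor
        · intro h
          exact ⟨a, Or.inl ⟨rfl, h⟩⟩
        · rintro ⟨u, ⟨rfl, h⟩ | ⟨rfl, rfl⟩⟩
          · exact h
          · exact hσ u
    have hM : weight p M = ∑ e ∈ Finset.univ.image fun u => s(u, σ u), edgeWeight p e := by
      unfold weight
      rw [hedge]
      exact finsum_mem_coe_finset _ _
    rw [hM, Finset.mul_sum]
    have hmaps : ∀ u ∈ (Finset.univ : Finset V),
        s(u, σ u) ∈ Finset.univ.image fun u => s(u, σ u) :=
      fun u hu => Finset.mem_image_of_mem _ hu
    -- Each edge arises from exactly its two ends, which accounts for the factor `2`.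
    rw [← Finset.sum_fiberwise_of_maps_to hmaps]
    refine Finset.sum_congr rfl fun e he => ?_
    obtain ⟨v, -, rfl⟩ := Finset.mem_image.1 he
    have hfib : ({u | s(u, σ u) = s(v, σ v)} : Finset V) = {v, σ v} := by
      ext u
      simp only [Finset.mem_filter, Finset.mem_univ, true_and, Sym2.eq_iff, Finset.mem_insert,
        Finset.mem_singleton]
      constructor
      · rintro (⟨h, -⟩ | ⟨h, -⟩)
        · exact Or.inl h
        · exact Or.inr h
      · rintro (rfl | rfl)
        · exact Or.inl ⟨rfl, rfl⟩
        · exact Or.inr ⟨rfl, hσ v⟩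
    rw [hfib, Finset.sum_pair (hne v).symm, hσ, dist_comm (p (σ v)), two_mul]
    rfl

theorem weight_pairMatching (n : ℕ) (p : Fin n ⊕ Fin n → X) :
    weight p (pairMatching n) = ∑ i, dist (p (Sum.inl i)) (p (Sum.inr i)) := by
  have hedge : (pairMatching n).edgeSet = Set.range fun i : Fin n =>
      s((Sum.inl i : Fin n ⊕ Fin n), Sum.inr i) := by
    ext e
    induction e using Sym2.ind with
    | h a b =>
      rw [SimpleGraph.Subgraph.mem_edgeSet]
      simp only [pairMatching, Set.mem_range, Sym2.eq_iff]
      refine exists_congr fun i => or_congr ?_ ?_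
      · exact and_congr eq_comm eq_comm
      · rw [and_comm]
        exact and_congr eq_comm eq_comm
  unfold weight
  rw [hedge, finsum_mem_range, finsum_eq_sum_of_fintype]
  · rfl
  · intro i j hij
    simpa using hij

end

section
variable {X : Type*} [MetricSpace X] {n : ℕ}

/-- The number of edges of the pair matching that cross the cut of `D`. -/
noncomputable def crossing (D : Finset (Fin n ⊕ Fin n)) : ℝ :=
  ∑ i : Fin n, cutIndicator (Sum.inl i) (Sum.inr i) D

/-- An uncrossed set is a union of pairs and hence even. -/
theorem one_le_crossing {D : Finset (Fin n ⊕ Fin n)} (hD : D ∈ oddSets (Fin n ⊕ Fin n)) :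
    1 ≤ crossing D := by
  obtain ⟨i, hi⟩ : ∃ i : Fin n, Separates D (Sum.inl i) (Sum.inr i) := by
    by_contra! h
    have hcard : D.card = ∑ i : Fin n, ((if Sum.inl i ∈ D then 1 else 0) +
        (if Sum.inr i ∈ D then 1 else 0)) := by
      rw [Finset.sum_add_distrib, ← Fintype.sum_sum_type
        (f := fun v : Fin n ⊕ Fin n => if v ∈ D then 1 else 0)]
      simp
    rw [mem_oddSets, hcard] at hD
    refine Nat.not_odd_iff_even.2 (Finset.even_sum _ fun i _ => ?_) hD
    have := not_not.1 (h i)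
    by_cases h1 : Sum.inl i ∈ D
    · simp [h1, this.1 h1]
    · have h2 : Sum.inr i ∉ D := fun h2 => h1 (this.2 h2)
      simp [h1, h2]
  rw [← cutIndicator_eq_one hi]
  exact Finset.single_le_sum (f := fun i : Fin n => cutIndicator (Sum.inl i) (Sum.inr i) D)
    (fun j _ => cutIndicator_nonneg _ _ _) (Finset.mem_univ i)

theorem cutIndicator_compl {V : Type*} [Fintype V] [DecidableEq V] (u v : V) (D : Finset V) :
    cutIndicator u v Dᶜ = cutIndicator u v D := by
  unfold cutIndicator
  refine if_congr ?_ rfl rfl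
  simp [Separates, not_iff_not]

theorem crossing_singleton (v : Fin n ⊕ Fin n) : crossing {v} = 1 := by
  unfold crossing
  rcases v with j | j
  all_goals
    rw [Finset.sum_eq_single_of_mem j (Finset.mem_univ j)]
    · exact cutIndicator_eq_one (by simp [Separates])
    · intro i _ hij
      exact cutIndicator_eq_zero (by simp [Separates, hij])

/-- Trivial cuts may carry negative weight in the dual program, so weak duality needs equality for
them. -/
theorem crossing_of_isTrivialCut {D : Finset (Fin n ⊕ Fin n)} (h : IsTrivialCut D) :
    crossing D = 1 := by
  rcases h with h | h
  · obtain ⟨v, rfl⟩ := Finset.card_eq_one.1 h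
    exact crossing_singleton v
  · obtain ⟨v, hv⟩ := Finset.card_eq_one.1 h
    rw [← crossing_singleton v, ← hv]
    exact Finset.sum_congr rfl fun i _ => (cutIndicator_compl _ _ _).symm

theorem sum_mul_crossing (z : Finset (Fin n ⊕ Fin n) → ℝ) :
    ∑ D ∈ oddSets (Fin n ⊕ Fin n), crossing D * z D =
      ∑ i : Fin n, oddPairing (cutIndicator (Sum.inl i) (Sum.inr i)) z := by
  simp only [oddPairing_apply, crossing, Finset.sum_mul]
  exact Finset.sum_comm

/-- Weak duality. -/
theorem IsDualFeasible.sum_le {p : Fin n ⊕ Fin n → X} {z : Finset (Fin n ⊕ Fin n) → ℝ}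
    (h : IsDualFeasible p z) :
    ∑ D ∈ oddSets (Fin n ⊕ Fin n), z D ≤ ∑ i, dist (p (Sum.inl i)) (p (Sum.inr i)) := by
  calc ∑ D ∈ oddSets (Fin n ⊕ Fin n), z D
      ≤ ∑ D ∈ oddSets (Fin n ⊕ Fin n), crossing D * z D := by
        refine Finset.sum_le_sum fun D hD => ?_
        by_cases ht : IsTrivialCut D
        · rw [crossing_of_isTrivialCut ht, one_mul]
        · exact le_mul_of_one_le_left (h.1 D hD ht) (one_le_crossing hD)
    _ = ∑ i : Fin n, oddPairing (cutIndicator (Sum.inl i) (Sum.inr i)) z := sum_mul_crossing z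
    _ ≤ _ := by
        refine Finset.sum_le_sum fun i _ => ?_
        rw [oddPairing_cutIndicator]
        exact h.2 _ _ (by simp)

/-- For a minimum-weight perfect matching there is a laminar packing that satisfies complementary
slackness: the edges of the matching are tight, and each of them crosses exactly one of the sets
of positive weight. -/
theorem exists_isLaminarPacking_slack (hn : 0 < n) (p : Fin n ⊕ Fin n → X)
    (hmin : IsMinWeightPerfectMatching p (pairMatching n)) :
    ∃ z H, IsLaminarPacking p z H ∧ IsDualOptimal p z ∧
      (∀ i, IsTight p z (Sum.inl i) (Sum.inr i)) ∧ ∀ D ∈ H, z D = 0 ∨ crossing D = 1 := by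
  have hV : Even (Fintype.card (Fin n ⊕ Fin n)) := by simp
  have : Nonempty (Fin n ⊕ Fin n) := ⟨Sum.inl ⟨0, hn⟩⟩
  obtain ⟨z, hz⟩ := exists_isExtremalPacking hV p
  have hL := hz.isLaminarPacking
  obtain ⟨σ, h1, h2⟩ := hz.exists_near_matching hV _ Finset.univ le_rfl (Or.inl rfl) ∅
    (Finset.empty_subset _) (by simp) (by simp)
  obtain ⟨M, hM, hMw⟩ := exists_isPerfectMatching_of_involution p σ
    (fun u => (h1 u (Finset.mem_univ u)).2.1) (fun u => by
      rw [Ne, (h1 u (Finset.mem_univ u)).2.2]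
      simp)
  have hsum : weight p M = ∑ D ∈ oddSets (Fin n ⊕ Fin n), z D := by
    rw [h2] at hMw
    rw [mul_left_cancel₀ two_ne_zero hMw, ← oddPairing_one, hL.oddPairing_eq]
    rw [Finset.filter_true_of_mem]
    · simp
    · intro E hE
      refine ⟨Finset.ssubset_univ_iff.2 ?_, Finset.disjoint_empty_right E⟩
      rintro rfl
      exact Nat.not_odd_iff_even.2 hV (Finset.card_univ (α := Fin n ⊕ Fin n) ▸
        mem_oddSets.1 (hL.odd hE))
  -- The constructed tight matching has weight `∑ z D` and the given one is no heavier. With weak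
  -- duality this gives optimality also against competitors with negative weights on trivial cuts.
  have hle : ∑ i, dist (p (Sum.inl i)) (p (Sum.inr i)) ≤ ∑ D ∈ oddSets (Fin n ⊕ Fin n), z D := by
    rw [← weight_pairMatching, ← hsum]
    exact hmin.2 M hM
  have hfeas : IsDualFeasible p z := ⟨fun D hD _ => hz.nonneg D hD, fun u v _ => by
    rw [← oddPairing_cutIndicator]
    exact hz.cut_le u v⟩
  have hcut : ∀ i ∈ Finset.univ, oddPairing (cutIndicator (Sum.inl i) (Sum.inr i)) z ≤
      dist (p (Sum.inl i)) (p (Sum.inr i)) := fun i _ => hz.cut_le _ _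
  have hcross : ∀ D ∈ oddSets (Fin n ⊕ Fin n), z D ≤ crossing D * z D := fun D hD =>
    le_mul_of_one_le_left (hz.nonneg D hD) (one_le_crossing hD)
  -- These two inequalities join the dual value to the weight of the matching; `hle` closes the
  -- circle, so both are equalities term by term.
  have s1 := Finset.sum_le_sum hcut
  have s2 := Finset.sum_le_sum hcross
  rw [sum_mul_crossing] at s2
  refine ⟨z, moatFamily z, hL, ⟨hfeas, fun z' hz' => hz'.sum_le.trans hle⟩, fun i => ?_,
    fun D hD => ?_⟩
  · exact (Finset.sum_eq_sum_iff_of_le hcut).1 (le_antisymm s1 (hle.trans s2)) i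
      (Finset.mem_univ i)
  · have := (Finset.sum_eq_sum_iff_of_le hcross).1 (le_antisymm (by rwa [sum_mul_crossing])
      (by rw [sum_mul_crossing]; exact s1.trans hle)) D (hL.odd hD)
    by_cases h0 : z D = 0
    · exact Or.inl h0
    · exact Or.inr (mul_right_cancel₀ h0 (by rw [one_mul]; exact this.symm))

end

/-! ### Edge functions: joint Lipschitz bound and biorthogonality -/

section
variable {X V : Type*} [MetricSpace X] [Fintype V] [DecidableEq V]

/-- The sign with which the moat function of `D` enters the function of the edge `uv`. -/
noncomputable def crossSign (u v : V) (D : Finset V) : ℝ :=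
  (if v ∈ D then 1 else 0) - (if u ∈ D then 1 else 0)

theorem abs_crossSign {V : Type*} [DecidableEq V] (u v : V) (D : Finset V) :
    |crossSign u v D| = cutIndicator u v D := by
  unfold crossSign cutIndicator Separates
  by_cases hu : u ∈ D <;> by_cases hv : v ∈ D <;> simp [hu, hv]

theorem edgeFunction_eq_sum {V : Type*} [DecidableEq V] (p : V → X) (z : Finset V → ℝ)
    (H : Finset (Finset V)) (u v : V) (a : X) :
    edgeFunction p z H u v a = ∑ D ∈ H, crossSign u v D * moat p z H D a := by
  unfold edgeFunction
  rw [Finset.sum_filter, Finset.sum_filter, ← Finset.sum_sub_distrib]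
  refine Finset.sum_congr rfl fun D _ => ?_
  unfold crossSign
  by_cases hu : u ∈ D <;> by_cases hv : v ∈ D <;> simp [hu, hv]

theorem IsLaminarPacking.edgeFunction_sub {p : V → X} {z : Finset V → ℝ} {H : Finset (Finset V)}
    (h : IsLaminarPacking p z H) (u v u' v' : V) :
    edgeFunction p z H u v (p u') - edgeFunction p z H u v (p v') =
      ∑ D ∈ H, crossSign u v D * crossSign u' v' D * z D := by
  rw [edgeFunction_eq_sum, edgeFunction_eq_sum, ← Finset.sum_sub_distrib]
  refine Finset.sum_congr rfl fun D hD => ?_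
  rw [h.moat_vertex hD, h.moat_vertex hD]
  have hsign : crossSign u' v' D = (if u' ∈ D then 0 else 1) - (if v' ∈ D then 0 else 1) := by
    unfold crossSign
    by_cases hu : u' ∈ D <;> by_cases hv : v' ∈ D <;> simp [hu, hv]
  rw [hsign]
  split_ifs <;> ring

end

section
variable {X : Type*} [MetricSpace X] {n : ℕ}

/-- Summed over the edges, each moat is counted `crossing D` times: once by slackness, or harmlessly
if its width is zero and its moat function vanishes. -/
theorem IsLaminarPacking.sum_abs_edgeFunction_sub_le {p : Fin n ⊕ Fin n → X}
    {z : Finset (Fin n ⊕ Fin n) → ℝ} {H : Finset (Finset (Fin n ⊕ Fin n))}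
    (h : IsLaminarPacking p z H) (hs : ∀ D ∈ H, z D = 0 ∨ crossing D = 1) (a b : X) :
    ∑ i, |edgeFunction p z H (Sum.inl i) (Sum.inr i) a -
      edgeFunction p z H (Sum.inl i) (Sum.inr i) b| ≤ dist a b := by
  calc ∑ i, |edgeFunction p z H (Sum.inl i) (Sum.inr i) a -
        edgeFunction p z H (Sum.inl i) (Sum.inr i) b|
      ≤ ∑ i, ∑ D ∈ H, cutIndicator (Sum.inl i) (Sum.inr i) D *
          |moat p z H D a - moat p z H D b| := by
        refine Finset.sum_le_sum fun i _ => ?_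
        rw [edgeFunction_eq_sum, edgeFunction_eq_sum, ← Finset.sum_sub_distrib]
        refine (Finset.abs_sum_le_sum_abs _ _).trans_eq (Finset.sum_congr rfl fun D _ => ?_)
        rw [← mul_sub, abs_mul, abs_crossSign]
    _ = ∑ D ∈ H, crossing D * |moat p z H D a - moat p z H D b| := by
        rw [Finset.sum_comm]
        simp only [crossing, Finset.sum_mul]
    _ = ∑ D ∈ H, |moat p z H D a - moat p z H D b| := by
        refine Finset.sum_congr rfl fun D hD => ?_
        rcases hs D hD with h0 | h0
        · have hm : ∀ a, moat p z H D a = 0 := fun a =>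
            le_antisymm ((moat_le p z H D a).trans_eq h0) (h.moat_nonneg hD a)
          simp [hm]
        · rw [h0, one_mul]
    _ ≤ dist a b := h.sum_abs_moat_sub_le a b

/-- For `i = j` the squared signs recover the cut weight, which tightness equates with the distance.
For `i ≠ j` no set of positive weight is crossed by both edges. -/
theorem IsLaminarPacking.edgeFunction_sub_eq {p : Fin n ⊕ Fin n → X}
    {z : Finset (Fin n ⊕ Fin n) → ℝ} {H : Finset (Finset (Fin n ⊕ Fin n))}
    (h : IsLaminarPacking p z H) (ht : ∀ i, IsTight p z (Sum.inl i) (Sum.inr i))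
    (hs : ∀ D ∈ H, z D = 0 ∨ crossing D = 1) (i j : Fin n) :
    edgeFunction p z H (Sum.inl i) (Sum.inr i) (p (Sum.inl j)) -
      edgeFunction p z H (Sum.inl i) (Sum.inr i) (p (Sum.inr j)) =
      if i = j then dist (p (Sum.inl j)) (p (Sum.inr j)) else 0 := by
  rw [h.edgeFunction_sub]
  split_ifs with hij
  · subst hij
    rw [← ht i, h.oddPairing_eq]
    refine Finset.sum_congr rfl fun D _ => ?_
    rw [← abs_crossSign]
    congr 1
    unfold crossSign
    split_ifs <;> simp
  · refine Finset.sum_eq_zero fun D hD => ?_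
    rcases hs D hD with h0 | h0
    · rw [h0, mul_zero]
    · have hle : cutIndicator (Sum.inl i) (Sum.inr i) D +
          cutIndicator (Sum.inl j) (Sum.inr j) D ≤ 1 := by
        rw [← h0, ← Finset.sum_pair (f := fun i => cutIndicator (Sum.inl i) (Sum.inr i) D) hij]
        exact Finset.sum_le_sum_of_subset_of_nonneg (Finset.subset_univ _)
          fun k _ _ => cutIndicator_nonneg _ _ _
      have hz : crossSign (Sum.inl i) (Sum.inr i) D * crossSign (Sum.inl j) (Sum.inr j) D = 0 := by
        rw [← abs_eq_zero, abs_mul, abs_crossSign, abs_crossSign]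
        unfold cutIndicator at hle ⊢
        split_ifs at hle ⊢
        · norm_num at hle
        all_goals simp
      rw [hz, zero_mul]

end

/-! ### Functionals on the transportation cost space -/

section
variable {X : Type*} [MetricSpace X]

/-- A `1`-Lipschitz function on `X` induces a continuous linear functional on `TC(X)`. -/
theorem exists_functional (t : X → ℝ) (ht : LipschitzWith 1 t) :
    ∃ τ : TC X →L[ℝ] ℝ, ∀ f : TP X, τ (f : UniformSpace.Completion (TP X)) =
      Finsupp.linearCombination ℝ t (TP.toFun f) := by
  let T : TP X →L[ℝ] ℝ := LinearMap.mkContinuous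
    (Finsupp.linearCombination ℝ t ∘ₗ TP.toFun) 1 fun f => by
      rw [one_mul, Real.norm_eq_abs, abs_le]
      have h1 := pairing_le_norm f t ht
      have h2 := pairing_le_norm (-f) t ht
      rw [map_neg, map_neg, norm_neg] at h2
      exact ⟨by simpa using (by linarith : -‖f‖ ≤ Finsupp.linearCombination ℝ t (TP.toFun f)), h1⟩
  refine ⟨T.extend (UniformSpace.Completion.toComplL (𝕜 := ℝ)), fun f => ?_⟩
  exact ContinuousLinearMap.extend_eq T UniformSpace.Completion.denseRange_coe
    (UniformSpace.Completion.isUniformInducing_coe _) f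

/-- If functions jointly define a `1`-Lipschitz map into `ℓ¹`, then so do the induced
functionals. -/
theorem sum_abs_functional_le {ι : Type*} [Fintype ι] (t : ι → X → ℝ)
    (ht : ∀ a b, ∑ i, |t i a - t i b| ≤ dist a b) (τ : ι → TC X →L[ℝ] ℝ)
    (hτ : ∀ i, ∀ f : TP X, τ i (f : UniformSpace.Completion (TP X)) =
      Finsupp.linearCombination ℝ (t i) (TP.toFun f)) (f : TC X) :
    ∑ i, |τ i f| ≤ ‖f‖ := by
  -- The inequality is a closed condition, so it suffices to check it on `TP X`, where it is bounded
  -- by the cost of every plan.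
  induction f using UniformSpace.Completion.induction_on with
  | hp => exact isClosed_le (by fun_prop) continuous_norm
  | ih f =>
    rw [UniformSpace.Completion.norm_coe]
    refine le_norm fun κ hκ => ?_
    obtain ⟨m, a, x, y, ha, rfl, rfl⟩ := hκ
    calc ∑ i, |τ i _| ≤ ∑ i, ∑ k, a k * |t i (x k) - t i (y k)| := by
          refine Finset.sum_le_sum fun i _ => ?_
          rw [hτ]
          simp only [map_sum, map_smul, toFun_dipole, map_sub, Finsupp.linearCombination_single,
            smul_eq_mul, one_mul]
          refine (Finset.abs_sum_le_sum_abs _ _).trans_eq (Finset.sum_congr rfl fun k _ => ?_)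
          rw [abs_mul, abs_of_nonneg (ha k)]
      _ = ∑ k, a k * ∑ i, |t i (x k) - t i (y k)| := by
          rw [Finset.sum_comm]
          simp only [Finset.mul_sum]
      _ ≤ _ := Finset.sum_le_sum fun k _ => mul_le_mul_of_nonneg_left (ht _ _) (ha k)

theorem norm_tcDipole_le (u v : X) : ‖tcDipole u v‖ ≤ dist u v := by
  unfold tcDipole
  rw [UniformSpace.Completion.norm_coe]
  exact (isPlanCost_dipole u v).norm_le

end
end TransportCost

/-! ### The projection -/

theorem lemma2p1 {X : Type*} [MetricSpace X] (n : ℕ) (hn : 0 < n) (x y : Fin n → X)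
    (hinj : Function.Injective (Sum.elim x y))
    (hmin : IsMinWeightPerfectMatching (Sum.elim x y) (pairMatching n)) :
    ∃ P : TC X →L[ℝ] pairSpan x y,
      (∀ f : pairSpan x y, P f = f) ∧ Function.Surjective P ∧ ‖P‖ = 1 ∧
      ∃ (z : Finset (Fin n ⊕ Fin n) → ℝ) (H : Finset (Finset (Fin n ⊕ Fin n)))
        (t : Fin n → X → ℝ) (τ : Fin n → TC X →L[ℝ] ℝ),
        IsLaminarOptimalDual (Sum.elim x y) z H ∧
        (∀ i, t i = edgeFunction (Sum.elim x y) z H (Sum.inl i) (Sum.inr i)) ∧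
        (∀ i, LipschitzWith 1 (t i)) ∧
        (∀ i, IsInducedBy (τ i) (t i)) ∧
        (∀ i j, τ i ((dist (x j) (y j))⁻¹ • tcDipole (x j) (y j)) = if i = j then 1 else 0) ∧
        ∀ f : TC X,
          (P f : TC X) = ∑ i, τ i f • ((dist (x i) (y i))⁻¹ • tcDipole (x i) (y i)) := by
  obtain ⟨z, H, hL, hopt, htight, hslack⟩ := exists_isLaminarPacking_slack hn _ hmin
  let t : Fin n → X → ℝ := fun i => edgeFunction (Sum.elim x y) z H (Sum.inl i) (Sum.inr i)
  have hsum : ∀ a b, ∑ i, |t i a - t i b| ≤ dist a b := hL.sum_abs_edgeFunction_sub_le hslack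
  have hLip : ∀ i, LipschitzWith 1 (t i) := fun i => LipschitzWith.of_dist_le_mul fun a b => by
    rw [NNReal.coe_one, one_mul, Real.dist_eq]
    exact (Finset.single_le_sum (f := fun i => |t i a - t i b|) (fun _ _ => abs_nonneg _)
      (Finset.mem_univ i)).trans (hsum a b)
  choose τ hτ using fun i => exists_functional (t i) (hLip i)
  have hind : ∀ i, IsInducedBy (τ i) (t i) := by
    intro i u v
    unfold tcDipole
    rw [hτ, toFun_dipole]
    simp
  have hd : ∀ i, 0 < dist (x i) (y i) := fun i => dist_pos.2 fun h => by
    simpa using hinj (a₁ := Sum.inl i) (a₂ := Sum.inr i) h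
  let e : Fin n → TC X := fun i => (dist (x i) (y i))⁻¹ • tcDipole (x i) (y i)
  have hbi : ∀ i j, τ i (e j) = if i = j then 1 else 0 := by
    intro i j
    have := hL.edgeFunction_sub_eq htight hslack i j
    simp only [Sum.elim_inl, Sum.elim_inr] at this
    simp only [e]
    rw [map_smul, hind, smul_eq_mul]
    simp only [t]
    rw [this]
    split_ifs
    · exact inv_mul_cancel₀ (hd j).ne'
    · exact mul_zero _
  have he : ∀ i, e i ∈ pairSpan x y := fun i =>
    Submodule.smul_mem _ _ (Submodule.subset_span ⟨i, rfl⟩)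
  have hnorm : ∀ i, ‖e i‖ ≤ 1 := by
    intro i
    simp only [e]
    rw [norm_smul, norm_inv, Real.norm_of_nonneg dist_nonneg, inv_mul_le_one₀ (hd i)]
    exact norm_tcDipole_le _ _
  let P : TC X →L[ℝ] pairSpan x y := ∑ i, (τ i).smulRight (⟨e i, he i⟩ : pairSpan x y)
  have hP : ∀ f, (P f : TC X) = ∑ i, τ i f • e i := by
    intro f
    simp [P]
  have hPe : ∀ j, P (e j) = (⟨e j, he j⟩ : pairSpan x y) := by
    intro j
    apply Subtype.ext
    rw [hP]
    simp [hbi]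
  have hid : ∀ f : pairSpan x y, P f = f := by
    rintro ⟨f, hf⟩
    apply Subtype.ext
    induction hf using Submodule.span_induction with
    | mem g hg =>
      obtain ⟨j, rfl⟩ := hg
      have : tcDipole (x j) (y j) = dist (x j) (y j) • e j := by
        simp only [e]
        rw [smul_smul, mul_inv_cancel₀ (hd j).ne', one_smul]
      simp only [this, map_smul, hPe]
      rfl
    | zero => simp
    | add f g _ _ hf hg =>
      simp only [map_add, Submodule.coe_add] at hf hg ⊢
      rw [hf, hg]
    | smul c f _ hf =>
      simp only [map_smul, Submodule.coe_smul] at hf ⊢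
      rw [hf]
  refine ⟨P, hid, fun f => ⟨f, hid f⟩, le_antisymm ?_ ?_, z, H, t, τ, ?_, fun _ => rfl, hLip,
    hind, hbi, hP⟩
  -- The triangle inequality with `‖e i‖ ≤ 1` reduces the bound to the joint estimate `∑ |τ i f| ≤
  -- ‖f‖`; bounds on the separate functionals would only give `n`.
  · refine ContinuousLinearMap.opNorm_le_bound _ zero_le_one fun f => ?_
    rw [one_mul, ← Submodule.norm_coe, hP]
    refine (norm_sum_le _ _).trans (le_trans ?_ (sum_abs_functional_le t hsum τ hτ f))
    refine Finset.sum_le_sum fun i _ => ?_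
    rw [norm_smul, Real.norm_eq_abs]
    exact mul_le_of_le_one_right (abs_nonneg _) (hnorm i)
  -- A nonzero fixed vector of `P` forces norm at least one.
  · let j : Fin n := ⟨0, hn⟩
    have hej : e j ≠ 0 := by
      intro h
      have := hbi j j
      rw [h, map_zero, if_pos rfl] at this
      exact zero_ne_one this
    have h1 := P.le_opNorm (e j)
    rw [hPe, ← Submodule.norm_coe] at h1
    exact le_of_mul_le_mul_right (by rwa [one_mul]) (norm_pos_iff.2 hej)
  · exact ⟨hopt, hL.nonneg, hL.odd, hL.laminar, hL.singleton_mem, hL.pos_iff⟩
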